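/- Let $N\ge 2$ and $1<p\le q<\infty$, with $q<p^*=\frac{Np}{N-p}$ if $p<N$. Let $B_R\subseteq\mathbb{R}^N$ be the open ball of radius $R$ centered at the origin. For an open set $A\subseteq\mathbb{R}^N$ let $C^\infty_0(A)$ be the smooth real functions with compact support in $A$, let $W^{1,p}_0(A)$ be the closure of $C^\infty_0(A)$ in the Sobolev space $W^{1,p}(A)$, and put $$\lambda_{p,q}(A)=\inf_{\varphi\in C^\infty_0(A)}\Big\{\int_A|\nabla\varphi|^p\,dx\,:\,\|\varphi\|_{L^q(A)}=1\Big\}\in[0,+\infty],\qquad \mathcal{E}_{p,q}(A)=\sup_{R>0}\lambda_{p,q}\big(A\setminus\overline{B_R}\big)\in[0,+\infty].$$ Define $\mathfrak{d}_p(\theta)=(1-\theta)\big(1-\theta^{\frac{1}{2p}}\big)$ for $0\le\theta<1$. Let $\Omega\subseteq\mathbb{R}^N$ be an unbounded open set with $\mathcal{E}_{p,q}(\Omega)>0$. Let $(u_n)_{n\in\mathbb{N}}\subseteq W^{1,p}_0(\Omega)$ satisfy $\|u_n\|_{L^q(\Omega)}=1$ for every $n$, let $u_n$ converge weakly in $W^{1,p}(\Omega)$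 to some $u\in W^{1,p}_0(\Omega)$, and assume that there are a real number $0\le M<\mathcal{E}_{p,q}(\Omega)$ and an $n_0\in\mathbb{N}$ with $$\int_\Omega|\nabla u_n|^p\,dx\le M\qquad\text{for every } n\ge n_0.$$ Put $\theta_0=M/\mathcal{E}_{p,q}(\Omega)$ (with $\theta_0=0$ if $\mathcal{E}_{p,q}(\Omega)=+\infty$) and $\mathfrak{d}=\mathfrak{d}_p(\theta_0)$. Then $u\in L^q(\Omega)$ and $$\|u\|_{L^q(\Omega)}\ge\mathfrak{d}>0,$$ where $\mathfrak{d}<1$ if $\mathcal{E}_{p,q}(\Omega)<+\infty$, and $\mathfrak{d}=1$ if $\mathcal{E}_{p,q}(\Omega)=+\infty$. Moreover, for every fixed $M\ge 0$, $\mathfrak{d}_p(M/\mathcal{E})\to 1$ as $\mathcal{E}\to+\infty$. -/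

import Mathlib

open MeasureTheory Filter Topology TopologicalSpace Distributions
open scoped ENNReal NNReal ContDiff Gradient

noncomputable section

/-- `ℝ^N` with the Euclidean norm. -/
abbrev RN (N : ℕ) := EuclideanSpace ℝ (Fin N)

variable {N : ℕ}

theorem testFunction_continuous_gradient {Ω : Opens (RN N)} (φ : 𝓓(Ω, ℝ)) :
    Continuous (∇ (φ : RN N → ℝ)) :=
  (InnerProductSpace.toDual ℝ (RN N)).symm.continuous.comp
    (φ.contDiff.continuous_fderiv (by simp))

theorem testFunction_hasCompactSupport_gradient {Ω : Opens (RN N)} (φ : 𝓓(Ω, ℝ)) :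
    HasCompactSupport (∇ (φ : RN N → ℝ)) :=
  (φ.hasCompactSupport.fderiv ℝ).comp_left
    (g := (InnerProductSpace.toDual ℝ (RN N)).symm) (map_zero _)

theorem testFunction_gradient_eq_zero {Ω : Opens (RN N)} (φ : 𝓓(Ω, ℝ)) {x : RN N}
    (hx : x ∉ Ω) : ∇ (φ : RN N → ℝ) x = 0 := by
  have h : fderiv ℝ (φ : RN N → ℝ) x = 0 := by
    by_contra h
    exact hx (φ.tsupport_subset (support_fderiv_subset ℝ h))
  simp [gradient, h]

theorem testFunction_memLp {Ω : Opens (RN N)} (φ : 𝓓(Ω, ℝ)) (r : ℝ≥0∞)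
    (μ : Measure (RN N)) [IsFiniteMeasureOnCompacts μ] : MemLp (φ : RN N → ℝ) r μ :=
  φ.continuous.memLp_of_hasCompactSupport φ.hasCompactSupport

theorem testFunction_memLp_gradient {Ω : Opens (RN N)} (φ : 𝓓(Ω, ℝ)) (r : ℝ≥0∞)
    (μ : Measure (RN N)) [IsFiniteMeasureOnCompacts μ] : MemLp (∇ (φ : RN N → ℝ)) r μ :=
  (testFunction_continuous_gradient φ).memLp_of_hasCompactSupport
    (testFunction_hasCompactSupport_gradient φ)

/-- The vector field `g` is the weak gradient of `u` on the open set `Ω`: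
`∫_Ω u ∇φ = - ∫_Ω φ g` for every `φ ∈ C^∞_0(Ω)`. -/
def IsWeakGradient (Ω : Opens (RN N)) (u : RN N → ℝ) (g : RN N → RN N) : Prop :=
  ∀ φ : 𝓓(Ω, ℝ), ∫ x in (Ω : Set (RN N)), u x • ∇ (φ : RN N → ℝ) x
    = - ∫ x in (Ω : Set (RN N)), φ x • g x

/-- The space `L^p(Ω) × L^p(Ω; ℝ^N)` with the norm `‖u‖_{L^p} + ‖g‖_{L^p}`. -/
abbrev LpPair (Ω : Opens (RN N)) (p : ℝ) :=
  WithLp 1 (Lp ℝ (ENNReal.ofReal p) (volume.restrict (Ω : Set (RN N))) ×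
    Lp (RN N) (ENNReal.ofReal p) (volume.restrict (Ω : Set (RN N))))

section Integrability

variable {Ω : Opens (RN N)} {p : ℝ} [hp : Fact (1 ≤ ENNReal.ofReal p)]

theorem integrable_smul_gradient
    (u : Lp ℝ (ENNReal.ofReal p) (volume.restrict (Ω : Set (RN N)))) (φ : 𝓓(Ω, ℝ)) :
    Integrable (fun x => u x • ∇ (φ : RN N → ℝ) x) (volume.restrict (Ω : Set (RN N))) := by
  have : ENNReal.HolderTriple (ENNReal.ofReal p) (ENNReal.conjExponent (ENNReal.ofReal p)) 1 :=
    ENNReal.HolderConjugate.conjExponent hp.out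
  exact memLp_one_iff_integrable.1 <|
    (testFunction_memLp_gradient φ (ENNReal.conjExponent (ENNReal.ofReal p)) _).smul (Lp.memLp u)

theorem integrable_testFunction_smul
    (g : Lp (RN N) (ENNReal.ofReal p) (volume.restrict (Ω : Set (RN N)))) (φ : 𝓓(Ω, ℝ)) :
    Integrable (fun x => φ x • g x) (volume.restrict (Ω : Set (RN N))) := by
  have : ENNReal.HolderTriple (ENNReal.ofReal p) (ENNReal.conjExponent (ENNReal.ofReal p)) 1 :=
    ENNReal.HolderConjugate.conjExponent hp.out
  have : ENNReal.HolderTriple (ENNReal.conjExponent (ENNReal.ofReal p)) (ENNReal.ofReal p) 1 :=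
    ENNReal.HolderTriple.symm
  exact memLp_one_iff_integrable.1 <|
    (Lp.memLp g).smul (testFunction_memLp φ (ENNReal.conjExponent (ENNReal.ofReal p)) _)

end Integrability

/-- The Sobolev space `W^{1,p}(Ω)`: pairs `(u, ∇u)` of a function of `L^p(Ω)` and its weak gradient
in `L^p(Ω; ℝ^N)` (which is determined by `u`), with the norm `‖u‖_{L^p(Ω)} + ‖∇u‖_{L^p(Ω)}`. -/
def W1p (Ω : Opens (RN N)) (p : ℝ) [Fact (1 ≤ ENNReal.ofReal p)] :
    Submodule ℝ (LpPair Ω p) where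
  carrier := {w | IsWeakGradient Ω w.fst w.snd}
  zero_mem' φ := by
    have h1 : ∫ x in (Ω : Set (RN N)), (0 : LpPair Ω p).fst x • ∇ (φ : RN N → ℝ) x = 0 := by
      refine integral_eq_zero_of_ae ?_
      filter_upwards [Lp.coeFn_zero ℝ (ENNReal.ofReal p) (volume.restrict (Ω : Set (RN N)))]
        with x hx
      change (0 : Lp ℝ _ (volume.restrict (Ω : Set (RN N)))) x • _ = (0 : RN N)
      rw [hx, Pi.zero_apply, zero_smul]
    have h2 : ∫ x in (Ω : Set (RN N)), φ x • (0 : LpPair Ω p).snd x = 0 := by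
      refine integral_eq_zero_of_ae ?_
      filter_upwards [Lp.coeFn_zero (RN N) (ENNReal.ofReal p) (volume.restrict (Ω : Set (RN N)))]
        with x hx
      change _ • (0 : Lp (RN N) _ (volume.restrict (Ω : Set (RN N)))) x = (0 : RN N)
      rw [hx, Pi.zero_apply, smul_zero]
    rw [h1, h2, neg_zero]
  add_mem' {v w} hv hw φ := by
    have h1 : ∫ x in (Ω : Set (RN N)), (v + w).fst x • ∇ (φ : RN N → ℝ) x
        = ∫ x in (Ω : Set (RN N)), (v.fst x • ∇ (φ : RN N → ℝ) x + w.fst x • ∇ (φ : RN N → ℝ) x) := by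
      refine integral_congr_ae ?_
      filter_upwards [Lp.coeFn_add v.fst w.fst] with x hx
      rw [WithLp.add_fst, hx, Pi.add_apply, add_smul]
    have h2 : ∫ x in (Ω : Set (RN N)), φ x • (v + w).snd x
        = ∫ x in (Ω : Set (RN N)), (φ x • v.snd x + φ x • w.snd x) := by
      refine integral_congr_ae ?_
      filter_upwards [Lp.coeFn_add v.snd w.snd] with x hx
      rw [WithLp.add_snd, hx, Pi.add_apply, smul_add]
    rw [h1, h2, integral_add (integrable_smul_gradient _ _) (integrable_smul_gradient _ _),
      integral_add (integrable_testFunction_smul _ _) (integrable_testFunction_smul _ _),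
      hv φ, hw φ, neg_add]
  smul_mem' c w hw φ := by
    have h1 : ∫ x in (Ω : Set (RN N)), (c • w).fst x • ∇ (φ : RN N → ℝ) x
        = ∫ x in (Ω : Set (RN N)), c • (w.fst x • ∇ (φ : RN N → ℝ) x) := by
      refine integral_congr_ae ?_
      filter_upwards [Lp.coeFn_smul c w.fst] with x hx
      rw [WithLp.smul_fst, hx, Pi.smul_apply, smul_assoc]
    have h2 : ∫ x in (Ω : Set (RN N)), φ x • (c • w).snd x
        = ∫ x in (Ω : Set (RN N)), c • (φ x • w.snd x) := by
      refine integral_congr_ae ?_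
      filter_upwards [Lp.coeFn_smul c w.snd] with x hx
      rw [WithLp.smul_snd, hx, Pi.smul_apply, smul_comm]
    rw [h1, h2, integral_smul, integral_smul, hw φ, smul_neg]

/-- The classical gradient of a test function is its weak gradient. -/
theorem testFunction_isWeakGradient {Ω : Opens (RN N)} (ψ : 𝓓(Ω, ℝ)) :
    IsWeakGradient Ω ψ (∇ (ψ : RN N → ℝ)) := by
  intro φ
  have i1 : ∀ a b : 𝓓(Ω, ℝ), Integrable (fun x => a x • ∇ (b : RN N → ℝ) x) := fun a b =>
    (a.continuous.smul (testFunction_continuous_gradient b)).integrable_of_hasCompactSupport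
      a.hasCompactSupport.smul_right
  have i2 : Integrable (fun x => ψ x * φ x) :=
    (ψ.continuous.mul φ.continuous).integrable_of_hasCompactSupport
      φ.hasCompactSupport.mul_left
  have hz : ∀ a b : 𝓓(Ω, ℝ), ∫ x in (Ω : Set (RN N)), a x • ∇ (b : RN N → ℝ) x
      = ∫ x, a x • ∇ (b : RN N → ℝ) x := fun a b =>
    setIntegral_eq_integral_of_forall_compl_eq_zero fun x hx => by
      rw [testFunction_gradient_eq_zero b hx, smul_zero]
  have hd : ∀ a : 𝓓(Ω, ℝ), Differentiable ℝ a := fun a => a.contDiff.differentiable (by simp)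
  have hin : ∀ (a b : 𝓓(Ω, ℝ)) (v x : RN N),
      inner ℝ v (a x • ∇ (b : RN N → ℝ) x) = a x * fderiv ℝ b x v := fun a b v x => by
    rw [inner_smul_right, real_inner_comm, gradient, InnerProductSpace.toDual_symm_apply]
  rw [hz, hz]
  refine ext_inner_left ℝ fun v => ?_
  rw [inner_neg_right, ← integral_inner (i1 ψ φ), ← integral_inner (i1 φ ψ)]
  simp only [hin]
  have j : ∀ a b : 𝓓(Ω, ℝ), Integrable (fun x => a x * fderiv ℝ b x v) := fun a b => by
    have := (i1 a b).const_inner (𝕜 := ℝ) v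
    simpa only [hin] using this
  have := integral_mul_fderiv_eq_neg_fderiv_mul_of_integrable (μ := volume) (v := v)
    (f := ψ) (g := φ) (by simpa only [mul_comm] using j φ ψ) (j ψ φ) i2 (fun x _ => hd ψ x) (fun x _ => hd φ x)
  simpa only [mul_comm] using this

namespace W1p

variable {Ω : Opens (RN N)} {p : ℝ} [Fact (1 ≤ ENNReal.ofReal p)]

/-- The function underlying an element of `W^{1,p}(Ω)` (a representative, meaningful on `Ω`). -/
def fn (w : W1p Ω p) : RN N → ℝ := (w : LpPair Ω p).fst

/-- The weak gradient of an element of `W^{1,p}(Ω)` (a representative, meaningful on `Ω`). -/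
def grad (w : W1p Ω p) : RN N → RN N := (w : LpPair Ω p).snd

/-- The inclusion of `C^∞_0(Ω)` in `W^{1,p}(Ω)`. -/
def ofTestFunction (φ : 𝓓(Ω, ℝ)) : W1p Ω p :=
  ⟨WithLp.toLp 1 ((testFunction_memLp φ _ _).toLp φ,
    (testFunction_memLp_gradient φ _ _).toLp (∇ (φ : RN N → ℝ))), by
    intro ψ
    have h1 := (testFunction_memLp φ (ENNReal.ofReal p)
      (volume.restrict (Ω : Set (RN N)))).coeFn_toLp
    have h2 := (testFunction_memLp_gradient φ (ENNReal.ofReal p)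
      (volume.restrict (Ω : Set (RN N)))).coeFn_toLp
    refine Eq.trans (integral_congr_ae ?_) ((testFunction_isWeakGradient φ ψ).trans
      (congrArg Neg.neg (integral_congr_ae ?_)))
    · filter_upwards [h1] with x hx
      simp [hx]
    · filter_upwards [h2] with x hx
      simp [hx]⟩

end W1p

/-- `W^{1,p}_0(Ω)`: the closure of `C^∞_0(Ω)` in `W^{1,p}(Ω)`. -/
def W1p0 (Ω : Opens (RN N)) (p : ℝ) [Fact (1 ≤ ENNReal.ofReal p)] : Set (W1p Ω p) :=
  closure (Set.range fun φ : 𝓓(Ω, ℝ) => W1p.ofTestFunction φ)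

/-- The `L^q(Ω)` norm, with values in `[0, ∞]`. -/
def normLq (Ω : Opens (RN N)) (q : ℝ) (u : RN N → ℝ) : ℝ≥0∞ :=
  eLpNorm u (ENNReal.ofReal q) (volume.restrict (Ω : Set (RN N)))

/-- `S_{p,q}(Ω)`: the functions of `W^{1,p}_0(Ω)` with unit `L^q(Ω)` norm. -/
def unitSphereLq (Ω : Opens (RN N)) (p q : ℝ) [Fact (1 ≤ ENNReal.ofReal p)] : Set (W1p Ω p) :=
  {u | u ∈ W1p0 Ω p ∧ normLq Ω q (W1p.fn u) = 1}

/-- `∫_Ω |g|^p dx`, with values in `[0, ∞]`. -/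
def energy (Ω : Opens (RN N)) (p : ℝ) (g : RN N → RN N) : ℝ≥0∞ :=
  ∫⁻ x in (Ω : Set (RN N)), ‖g x‖ₑ ^ p

/-- The sharp Poincaré-Sobolev constant `λ_{p,q}(Ω)`, the infimum of `∫_Ω |∇φ|^p dx` over the
`φ ∈ C^∞_0(Ω)` with unit `L^q(Ω)` norm (it is `∞` for the empty set). -/
def poincareSobolev (Ω : Opens (RN N)) (p q : ℝ) : ℝ≥0∞ :=
  ⨅ (φ : 𝓓(Ω, ℝ)) (_ : normLq Ω q φ = 1), energy Ω p (∇ (φ : RN N → ℝ))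

/-- The open set `Ω \ closure B_R`, with `B_R` the ball of radius `R` centered at the origin. -/
def removeBall (Ω : Opens (RN N)) (R : ℝ) : Opens (RN N) :=
  ⟨(Ω : Set (RN N)) \ closure (Metric.ball 0 R), Ω.isOpen.sdiff isClosed_closure⟩

/-- The Poincaré-Sobolev constant at infinity, `sup_{R > 0} λ_{p,q}(Ω \ closure B_R)`. -/
def poincareSobolevInfty (Ω : Opens (RN N)) (p q : ℝ) : ℝ≥0∞ :=
  ⨆ (R : ℝ) (_ : 0 < R), poincareSobolev (removeBall Ω R) p q

/-- Subcriticality of a finite exponent: `q < p^* = N p / (N - p)` if `p < N` (and `q < ∞`,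
which is automatic for a real `q`, if `p ≥ N`). -/
def IsSubcritical (N : ℕ) (p q : ℝ) : Prop :=
  p < N → q < N * p / (N - p)

/-- The constant `(1 - θ) (1 - θ^{1 / (2 p)})`. -/
def avanzo (p θ : ℝ) : ℝ := (1 - θ) * (1 - θ ^ (1 / (2 * p)))

end

/-! Mass that a weakly convergent sequence loses can only escape to infinity, where each unit of
`L^q` norm costs energy at least `E = poincareSobolevInfty Ω p q`; a sequence with energy at most `M
< E` cannot afford to lose everything.

Fix `t < E` and a radius `R` with `t < λ(Ω \ closure B_R)`, and let `η + χ = 1`, where `χ` has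
compact support, `η` vanishes on a ball larger than `B_R` and both gradients are at most `ε`.
Poincaré-Sobolev outside the ball gives `t^{1/p} ‖η u_n‖_q ≤ ‖∇u_n‖_p + ε ‖u_n‖_p`
(`rpow_mul_eLpNorm_cutoff_le`). Local compactness gives `χ (u_n - u) → 0` in `L^q`, so that `‖χ
u_n‖_q ≤ ‖u‖_q + o(1)` (`W1p.tendsto_eLpNorm_cutoff_zero_of_weak`). Adding the two, with `‖u_n‖_q =
1`, and letting `n → ∞` and then `ε → 0` yields `t^{1/p} ≤ M^{1/p} + t^{1/p} ‖u‖_q`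
(`W1p.rpow_le_add_mul_normLq_of_weak`). As `t → E` this becomes `‖u‖_q ≥ 1 - θ₀^{1/p}`, which is at
least `avanzo p θ₀`.

The inequalities are proved for test functions and carried to `W^{1,p}_0` by density. Density
controls `L^q` norms because `E > 0` forces a global Sobolev inequality: the exterior part is
handled by `E`, the interior part by the Sobolev inequality on a ball.

Compactness rests on averages over balls: a function is within `r ‖∇f‖_p` of its average at scale
`r`, and for fixed `r` the averages of a weakly null sequence tend to zero boundedly. Averages over
very large balls also show that an element of `W^{1,p}_0` with zero gradient vanishes; hence `M >
0`, which makes the constant strictly less than one when `E` is finite. -/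

/-! ### Jensen, interpolation and lower semicontinuity for Lebesgue norms -/

section LpEstimates

variable {α : Type*} {mα : MeasurableSpace α} {μ : Measure α} {F : Type*} [NormedAddCommGroup F]

theorem lintegral_enorm_rpow_eq_eLpNorm_rpow {p : ℝ} (hp : 0 < p) (f : α → F) :
    ∫⁻ x, ‖f x‖ₑ ^ p ∂μ = eLpNorm f (ENNReal.ofReal p) μ ^ p := by
  have h0 : ENNReal.ofReal p ≠ 0 := (ENNReal.ofReal_pos.2 hp).ne'
  rw [eLpNorm_eq_eLpNorm' h0 ENNReal.ofReal_ne_top, ENNReal.toReal_ofReal hp.le,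
    lintegral_rpow_enorm_eq_rpow_eLpNorm' hp]

/-- Jensen's inequality, in the form of monotonicity of `L^p` norms in the exponent on a probability
space. -/
theorem rpow_lintegral_enorm_le_lintegral_enorm_rpow [IsProbabilityMeasure μ] {p : ℝ} (hp : 1 ≤ p)
    {f : α → F} (hf : AEStronglyMeasurable f μ) :
    (∫⁻ x, ‖f x‖ₑ ∂μ) ^ p ≤ ∫⁻ x, ‖f x‖ₑ ^ p ∂μ := by
  rw [lintegral_enorm_rpow_eq_eLpNorm_rpow (by linarith), ← eLpNorm_one_eq_lintegral_enorm]
  gcongr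
  exact eLpNorm_le_eLpNorm_of_exponent_le (by simpa using hp) hf

/-- Interpolation between Lebesgue norms. -/
theorem eLpNorm_rpow_le_mul_of_convex_combination {p q r a b : ℝ} (hp : 0 < p) (hq : 0 < q)
    (hr : 0 < r) (ha : 0 ≤ a) (hb : 0 ≤ b) (hab : a + b = 1) (h : a * p + b * r = q)
    {f : α → F} (hf : AEStronglyMeasurable f μ) :
    eLpNorm f (ENNReal.ofReal q) μ ^ q ≤
      (eLpNorm f (ENNReal.ofReal p) μ ^ p) ^ a * (eLpNorm f (ENNReal.ofReal r) μ ^ r) ^ b := by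
  rw [← lintegral_enorm_rpow_eq_eLpNorm_rpow hq, ← lintegral_enorm_rpow_eq_eLpNorm_rpow hp,
    ← lintegral_enorm_rpow_eq_eLpNorm_rpow hr]
  refine le_trans (le_of_eq (lintegral_congr fun x => ?_))
    (ENNReal.lintegral_mul_norm_pow_le (hf.enorm.pow_const p) (hf.enorm.pow_const r) ha hb hab)
  rw [← ENNReal.rpow_mul, ← ENNReal.rpow_mul, ← ENNReal.rpow_add_of_nonneg _ _
    (by positivity) (by positivity), ← h, mul_comm p, mul_comm r]

/-- Lower semicontinuity of the `L^q` norm along convergence in `L^p`. -/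
theorem eLpNorm_le_of_tendsto_eLpNorm_sub {p q : ℝ≥0∞} (hp : p ≠ 0) {f : ℕ → α → F} {g : α → F}
    (hf : ∀ n, AEStronglyMeasurable (f n) μ) (hg : AEStronglyMeasurable g μ)
    (hfg : Tendsto (fun n => eLpNorm (f n - g) p μ) atTop (𝓝 0)) {c : ℝ≥0∞} {b : ℕ → ℝ≥0∞}
    (hb : ∀ n, eLpNorm (f n) q μ ≤ b n) (hbc : Tendsto b atTop (𝓝 c)) : eLpNorm g q μ ≤ c := by
  obtain ⟨ns, hns, hae⟩ :=
    (tendstoInMeasure_of_tendsto_eLpNorm hp hf hg hfg).exists_seq_tendsto_ae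
  refine (Lp.eLpNorm_lim_le_liminf_eLpNorm (fun n => hf (ns n)) g hae).trans ?_
  rw [← (hbc.comp hns.tendsto_atTop).liminf_eq]
  exact liminf_le_liminf (Eventually.of_forall fun n => hb _)

end LpEstimates

/-! ### Translations and averages over balls -/

section Translations

variable {f : RN N → ℝ} {p : ℝ}

/-- The fundamental theorem of calculus along the segment from `x` to `x + h`. -/
theorem enorm_translate_sub_le_lintegral (hf : ContDiff ℝ 1 f) (x h : RN N) :
    ‖f (x + h) - f x‖ₑ ≤
      ‖h‖ₑ * ∫⁻ t in Set.Ioc (0 : ℝ) 1, ‖fderiv ℝ f (x + t • h)‖ₑ := by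
  have hd : ∀ t : ℝ, HasDerivAt (fun t : ℝ => f (x + t • h)) (fderiv ℝ f (x + t • h) h) t := by
    intro t
    have h1 : HasDerivAt (fun t : ℝ => x + t • h) h t := by
      simpa using ((hasDerivAt_id t).smul_const h).const_add x
    exact ((hf.differentiable (by simp)) (x + t • h)).hasFDerivAt.comp_hasDerivAt t h1
  have hc : Continuous fun t : ℝ => fderiv ℝ f (x + t • h) :=
    (hf.continuous_fderiv (by simp)).comp (by fun_prop)
  have hi := intervalIntegral.integral_eq_sub_of_hasDerivAt (fun t _ => hd t)
    ((hc.clm_apply continuous_const).intervalIntegrable 0 1)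
  simp only [one_smul, zero_smul, add_zero] at hi
  rw [← hi, intervalIntegral.integral_of_le zero_le_one, ← lintegral_const_mul' _ _ enorm_ne_top]
  refine (enorm_integral_le_lintegral_enorm _).trans (lintegral_mono fun t => ?_)
  rw [mul_comm]
  exact ContinuousLinearMap.le_opENorm _ _

/-- Jensen in the parameter of the segment, then Tonelli: for each `t`, translation by `t • h`
preserves the integral of the gradient. -/
theorem lintegral_enorm_translate_sub_rpow_le (hf : ContDiff ℝ 1 f) (hp : 1 ≤ p) (h : RN N) :
    ∫⁻ x, ‖f (x + h) - f x‖ₑ ^ p ≤ ‖h‖ₑ ^ p * ∫⁻ x, ‖fderiv ℝ f x‖ₑ ^ p := by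
  have hp0 : 0 ≤ p := by linarith
  have hc : Continuous (fderiv ℝ f) := hf.continuous_fderiv (by simp)
  have hP : IsProbabilityMeasure ((volume : Measure ℝ).restrict (Set.Ioc 0 1)) :=
    ⟨by simp⟩
  calc ∫⁻ x, ‖f (x + h) - f x‖ₑ ^ p
      ≤ ∫⁻ x, ‖h‖ₑ ^ p * ∫⁻ t in Set.Ioc (0 : ℝ) 1, ‖fderiv ℝ f (x + t • h)‖ₑ ^ p := by
        refine lintegral_mono fun x => ?_
        refine (ENNReal.rpow_le_rpow (enorm_translate_sub_le_lintegral hf x h) hp0).trans ?_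
        rw [ENNReal.mul_rpow_of_nonneg _ _ hp0]
        gcongr
        exact rpow_lintegral_enorm_le_lintegral_enorm_rpow hp
          (hc.comp (by fun_prop : Continuous fun t : ℝ => x + t • h)).aestronglyMeasurable
    _ = ‖h‖ₑ ^ p * ∫⁻ t in Set.Ioc (0 : ℝ) 1, ∫⁻ x, ‖fderiv ℝ f (x + t • h)‖ₑ ^ p := by
        rw [lintegral_const_mul' _ _ (ENNReal.rpow_ne_top_of_nonneg hp0 enorm_ne_top),
          lintegral_lintegral_swap]
        have : Continuous fun z : RN N × ℝ => ‖fderiv ℝ f (z.1 + z.2 • h)‖ₑ :=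
          (hc.comp (by fun_prop)).enorm
        exact (this.measurable.pow_const p).aemeasurable
    _ = ‖h‖ₑ ^ p * ∫⁻ x, ‖fderiv ℝ f x‖ₑ ^ p := by
        congr 1
        have : ∀ t : ℝ, ∫⁻ x, ‖fderiv ℝ f (x + t • h)‖ₑ ^ p = ∫⁻ x, ‖fderiv ℝ f x‖ₑ ^ p := fun t =>
          lintegral_add_right_eq_self (fun x => ‖fderiv ℝ f x‖ₑ ^ p) (t • h)
        simp [this]

/-- Moves the dependence on `x` from the domain to the integrand, where Tonelli and measurability of
parametric integrals apply. -/
theorem setAverage_ball_eq (f : RN N → ℝ) (x : RN N) (r : ℝ) :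
    ⨍ y in Metric.ball x r, f y = ⨍ h in Metric.ball (0 : RN N) r, f (x + h) := by
  have h1 : MeasurePreserving (fun h : RN N => x + h) := measurePreserving_add_left volume x
  have h2 : (fun h : RN N => x + h) ⁻¹' Metric.ball x r = Metric.ball 0 r := by
    ext h
    simp
  rw [setAverage_eq, setAverage_eq, ← h2, h1.setIntegral_preimage_emb
    (Homeomorph.addLeft x).measurableEmbedding, Measure.real, Measure.real,
    h1.measure_preimage_emb (Homeomorph.addLeft x).measurableEmbedding]

/-- The mean oscillation of a function on balls of radius `r` is controlled by its gradient. -/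
theorem eLpNorm_sub_setAverage_le (hf : ContDiff ℝ 1 f) (hp : 1 ≤ p) {r : ℝ} (hr : 0 < r) :
    eLpNorm (fun x => f x - ⨍ y in Metric.ball x r, f y) (ENNReal.ofReal p) volume ≤
      ENNReal.ofReal r * eLpNorm (fderiv ℝ f) (ENNReal.ofReal p) volume := by
  have hp0 : 0 < p := by linarith
  set B := Metric.ball (0 : RN N) r with hB
  have hB0 : volume B ≠ 0 := (Metric.measure_ball_pos _ _ hr).ne'
  have hBt : volume B ≠ ⊤ := measure_ball_lt_top.ne
  set ν : Measure (RN N) := (volume B)⁻¹ • volume.restrict B with hν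
  have hνP : IsProbabilityMeasure ν := ⟨by simp [hν, ENNReal.inv_mul_cancel hB0 hBt]⟩
  have hav : ∀ x, ⨍ y in Metric.ball x r, f y = ∫ h, f (x + h) ∂ν := fun x => by
    rw [setAverage_ball_eq, average, Measure.restrict_apply_univ]
  have hae : ∀ᵐ h ∂ν, h ∈ B := Measure.ae_smul_measure (ae_restrict_mem measurableSet_ball) _
  rw [← ENNReal.rpow_le_rpow_iff hp0, ENNReal.mul_rpow_of_nonneg _ _ hp0.le,
    ← lintegral_enorm_rpow_eq_eLpNorm_rpow hp0, ← lintegral_enorm_rpow_eq_eLpNorm_rpow hp0]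
  have hcx : ∀ x, Continuous fun h => f (x + h) := fun x => hf.continuous.comp (by fun_prop)
  have hint : ∀ x, Integrable (fun h => f (x + h)) ν := fun x => by
    refine Integrable.smul_measure ?_ (ENNReal.inv_ne_top.2 hB0)
    exact ((hcx x).continuousOn.integrableOn_compact
      (isCompact_closedBall (0 : RN N) r)).mono_set Metric.ball_subset_closedBall
  calc ∫⁻ x, ‖f x - ⨍ y in Metric.ball x r, f y‖ₑ ^ p
      -- The oscillation at `x` is the mean of the increments `f (x + h) - f x` under the uniform
      -- probability `ν` on the ball, so Jensen reduces the claim to translations with `‖h‖ < r`.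
      ≤ ∫⁻ x, ∫⁻ h, ‖f (x + h) - f x‖ₑ ^ p ∂ν := by
        refine lintegral_mono fun x => ?_
        refine le_trans (ENNReal.rpow_le_rpow ?_ hp0.le)
          (rpow_lintegral_enorm_le_lintegral_enorm_rpow hp
            ((hcx x).sub continuous_const).aestronglyMeasurable)
        rw [hav, enorm_sub_rev]
        refine le_trans (le_of_eq ?_) (enorm_integral_le_lintegral_enorm _)
        rw [integral_sub (hint x) (integrable_const _)]
        simp
    _ = ∫⁻ h, (∫⁻ x, ‖f (x + h) - f x‖ₑ ^ p) ∂ν := by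
        rw [lintegral_lintegral_swap]
        have : Continuous fun z : RN N × RN N => ‖f (z.1 + z.2) - f z.1‖ₑ :=
          ((hf.continuous.comp (by fun_prop)).sub (hf.continuous.comp continuous_fst)).enorm
        exact (this.measurable.pow_const p).aemeasurable
    _ ≤ ∫⁻ _, (ENNReal.ofReal r ^ p * ∫⁻ x, ‖fderiv ℝ f x‖ₑ ^ p) ∂ν := by
        refine lintegral_mono_ae (hae.mono fun h hh => ?_)
        refine (lintegral_enorm_translate_sub_rpow_le hf hp h).trans ?_
        gcongr
        rw [← ofReal_norm]
        exact ENNReal.ofReal_le_ofReal (mem_ball_zero_iff.1 hh).le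
    _ = ENNReal.ofReal r ^ p * ∫⁻ x, ‖fderiv ℝ f x‖ₑ ^ p := by simp

/-- Jensen again. The bound is uniform in `x`, so it serves as a dominating constant for fixed `r`,
and its factor decays as the ball grows. -/
theorem enorm_setAverage_ball_le (hf : Continuous f) (hp : 1 ≤ p) {r : ℝ} (hr : 0 < r) (x : RN N) :
    ‖⨍ y in Metric.ball x r, f y‖ₑ ≤
      (volume (Metric.ball (0 : RN N) r))⁻¹ ^ p⁻¹ * eLpNorm f (ENNReal.ofReal p) volume := by
  have hp0 : 0 < p := by linarith
  set B := Metric.ball x r with hB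
  have hB0 : volume B ≠ 0 := (Metric.measure_ball_pos _ _ hr).ne'
  have hBt : volume B ≠ ⊤ := measure_ball_lt_top.ne
  have hBx : volume B = volume (Metric.ball (0 : RN N) r) := Measure.addHaar_ball_center _ _ _
  set ν : Measure (RN N) := (volume B)⁻¹ • volume.restrict B with hν
  have hνP : IsProbabilityMeasure ν := ⟨by simp [hν, ENNReal.inv_mul_cancel hB0 hBt]⟩
  have hav : ⨍ y in B, f y = ∫ h, f h ∂ν := by
    rw [average, Measure.restrict_apply_univ]
  rw [← ENNReal.rpow_le_rpow_iff hp0, ENNReal.mul_rpow_of_nonneg _ _ hp0.le, hav, ← hBx,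
    ← lintegral_enorm_rpow_eq_eLpNorm_rpow hp0, ← ENNReal.rpow_mul, inv_mul_cancel₀ hp0.ne',
    ENNReal.rpow_one]
  refine (ENNReal.rpow_le_rpow (enorm_integral_le_lintegral_enorm _) hp0.le).trans
    ((rpow_lintegral_enorm_le_lintegral_enorm_rpow hp hf.aestronglyMeasurable).trans ?_)
  rw [hν, lintegral_smul_measure, smul_eq_mul]
  gcongr
  exact Measure.restrict_le_self

end Translations

/-! ### Compactness in `L^p` on a ball -/

section LocalCompactness

variable {f : RN N → ℝ} {p : ℝ}

theorem stronglyMeasurable_setAverage_ball (hf : Continuous f) (r : ℝ) :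
    StronglyMeasurable fun x => ⨍ y in Metric.ball x r, f y := by
  have h : (fun x => ⨍ y in Metric.ball x r, f y) = fun x =>
      (volume.real (Metric.ball (0 : RN N) r))⁻¹ * ∫ h in Metric.ball (0 : RN N) r, f (x + h) :=
    funext fun x => by rw [setAverage_ball_eq, setAverage_eq, smul_eq_mul]
  have h2 : StronglyMeasurable (Function.uncurry fun x h : RN N => f (x + h)) :=
    (hf.comp (continuous_fst.add continuous_snd)).stronglyMeasurable
  have h3 := h2.integral_prod_right (ν := volume.restrict (Metric.ball 0 r))
  rw [h]
  exact h3.const_mul _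

theorem eLpNorm_restrict_le_add_eLpNorm_setAverage (hf : ContDiff ℝ 1 f) (hp : 1 ≤ p) {r : ℝ}
    (hr : 0 < r) (s : Set (RN N)) :
    eLpNorm f (ENNReal.ofReal p) (volume.restrict s) ≤
      ENNReal.ofReal r * eLpNorm (fderiv ℝ f) (ENNReal.ofReal p) volume +
        eLpNorm (fun x => ⨍ y in Metric.ball x r, f y) (ENNReal.ofReal p) (volume.restrict s) := by
  have hm := stronglyMeasurable_setAverage_ball hf.continuous r
  have h := eLpNorm_add_le (μ := volume.restrict s) (p := ENNReal.ofReal p)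
    (hf.continuous.aestronglyMeasurable.sub hm.aestronglyMeasurable) hm.aestronglyMeasurable
    (by simpa using hp)
  rw [sub_add_cancel] at h
  refine h.trans (add_le_add_left ?_ _)
  exact (eLpNorm_mono_measure _ Measure.restrict_le_self).trans (eLpNorm_sub_setAverage_le hf hp hr)

/-- Meant for `r` much larger than `ρ`: when the gradient is negligible, only the average over the
large ball remains, and it is small. -/
theorem eLpNorm_restrict_ball_le (hf : ContDiff ℝ 1 f) (hp : 1 ≤ p) {r : ℝ} (hr : 0 < r) (ρ : ℝ) :
    eLpNorm f (ENNReal.ofReal p) (volume.restrict (Metric.ball 0 ρ)) ≤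
      ENNReal.ofReal r * eLpNorm (fderiv ℝ f) (ENNReal.ofReal p) volume +
        volume (Metric.ball (0 : RN N) ρ) ^ p⁻¹ *
          ((volume (Metric.ball (0 : RN N) r))⁻¹ ^ p⁻¹ *
            eLpNorm f (ENNReal.ofReal p) volume) := by
  have hp0 : 0 < p := by linarith
  refine (eLpNorm_restrict_le_add_eLpNorm_setAverage hf hp hr _).trans (add_le_add_right ?_ _)
  refine (eLpNorm_le_of_ae_enorm_bound
    (Eventually.of_forall fun x => enorm_setAverage_ball_le hf.continuous hp hr x)).trans ?_
  rw [Measure.restrict_apply_univ, ENNReal.toReal_ofReal hp0.le, smul_eq_mul, mul_comm]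

/-- A sequence of functions supported in a fixed ball, bounded in `W^{1,p}` and with vanishing
local means, converges to zero in `L^p`. -/
theorem tendsto_eLpNorm_zero_of_setAverage {w : ℕ → RN N → ℝ} (hw : ∀ n, ContDiff ℝ 1 (w n))
    (hp : 1 ≤ p) {ρ : ℝ} (hs : ∀ n, (w n).support ⊆ Metric.ball 0 ρ) {D : ℝ≥0∞} (hD : D ≠ ⊤)
    (hwD : ∀ n, eLpNorm (w n) (ENNReal.ofReal p) volume ≤ D)
    (hgD : ∀ n, eLpNorm (fderiv ℝ (w n)) (ENNReal.ofReal p) volume ≤ D)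
    (hav : ∀ x : RN N, ∀ r : ℝ, 0 < r →
      Tendsto (fun n => ⨍ y in Metric.ball x r, w n y) atTop (𝓝 0)) :
    Tendsto (fun n => eLpNorm (w n) (ENNReal.ofReal p) volume) atTop (𝓝 0) := by
  have hp0 : 0 < p := by linarith
  set s := Metric.ball (0 : RN N) ρ with hs_def
  have hst : volume s ≠ ⊤ := measure_ball_lt_top.ne
  -- At a fixed scale the averages tend to zero pointwise and are uniformly bounded on a set of
  -- finite measure, so dominated convergence applies.
  have key : ∀ r : ℝ, 0 < r → Tendsto (fun n => eLpNorm (fun x => ⨍ y in Metric.ball x r, w n y)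
      (ENNReal.ofReal p) (volume.restrict s)) atTop (𝓝 0) := by
    intro r hr
    set c := (volume (Metric.ball (0 : RN N) r))⁻¹ ^ p⁻¹ * D with hc
    have hct : c ≠ ⊤ := ENNReal.mul_ne_top (ENNReal.rpow_ne_top_of_nonneg (inv_nonneg.2 hp0.le)
      (ENNReal.inv_ne_top.2 (Metric.measure_ball_pos _ _ hr).ne')) hD
    have hlim : Tendsto (fun n => ∫⁻ x in s, ‖⨍ y in Metric.ball x r, w n y‖ₑ ^ p) atTop
        (𝓝 (∫⁻ _ in s, 0)) := by
      refine tendsto_lintegral_of_dominated_convergence (fun _ => c ^ p) (fun n => ?_)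
        (fun n => Eventually.of_forall fun x => ?_) ?_ (Eventually.of_forall fun x => ?_)
      · exact ((stronglyMeasurable_setAverage_ball (hw n).continuous r).measurable.enorm).pow_const p
      · refine ENNReal.rpow_le_rpow ?_ hp0.le
        refine (enorm_setAverage_ball_le (hw n).continuous hp hr x).trans ?_
        rw [hc]
        gcongr
        exact hwD n
      · rw [lintegral_const, Measure.restrict_apply_univ]
        exact ENNReal.mul_ne_top (ENNReal.rpow_ne_top_of_nonneg hp0.le hct) hst
      · have h1 := (hav x r hr).enorm
        rw [enorm_zero] at h1
        have h2 := h1.ennrpow_const p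
        rwa [ENNReal.zero_rpow_of_pos hp0] at h2
    rw [lintegral_zero] at hlim
    have h3 := hlim.ennrpow_const p⁻¹
    rw [ENNReal.zero_rpow_of_pos (inv_pos.2 hp0)] at h3
    refine h3.congr fun n => ?_
    rw [lintegral_enorm_rpow_eq_eLpNorm_rpow hp0, ← ENNReal.rpow_mul, mul_inv_cancel₀ hp0.ne',
      ENNReal.rpow_one]
  have hle : ∀ r : ℝ, 0 < r → ∀ n, eLpNorm (w n) (ENNReal.ofReal p) volume ≤
      ENNReal.ofReal r * D + eLpNorm (fun x => ⨍ y in Metric.ball x r, w n y)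
        (ENNReal.ofReal p) (volume.restrict s) := by
    intro r hr n
    rw [← eLpNorm_restrict_eq_of_support_subset (hs n)]
    refine (eLpNorm_restrict_le_add_eLpNorm_setAverage (hw n) hp hr s).trans ?_
    gcongr
    exact hgD n
  rw [ENNReal.tendsto_nhds_zero]
  intro ε hε
  -- The scale is fixed first, so that the oscillation term is small uniformly in `n`; then `n` is
  -- sent to infinity at that scale.
  obtain ⟨δ, hδ0, hδ⟩ : ∃ δ : ℝ, 0 < δ ∧ ENNReal.ofReal δ * D < ε := by
    have h1 : Tendsto (fun δ : ℝ => ENNReal.ofReal δ * D) (𝓝[>] 0) (𝓝 0) := by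
      have h2 : Tendsto (fun δ : ℝ => ENNReal.ofReal δ * D) (𝓝 0) (𝓝 (ENNReal.ofReal 0 * D)) :=
        ENNReal.Tendsto.mul_const (ENNReal.continuous_ofReal.tendsto 0) (Or.inr hD)
      rw [ENNReal.ofReal_zero, zero_mul] at h2
      exact h2.mono_left nhdsWithin_le_nhds
    exact ((eventually_mem_nhdsWithin (s := Set.Ioi (0 : ℝ))).and
      (h1.eventually (gt_mem_nhds hε))).exists
  have h4 : Tendsto (fun n => ENNReal.ofReal δ * D + eLpNorm (fun x => ⨍ y in Metric.ball x δ, w n y)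
        (ENNReal.ofReal p) (volume.restrict s)) atTop (𝓝 (ENNReal.ofReal δ * D)) := by
    simpa using (key δ hδ0).const_add (ENNReal.ofReal δ * D)
  filter_upwards [h4.eventually (gt_mem_nhds hδ)] with n hn
  exact (hle δ hδ0 n).trans hn.le

end LocalCompactness

/-! ### Sobolev inequalities and compactness in `L^q` for functions supported in a ball -/

section Sobolev

variable {p q : ℝ}

/-- For `p < N` the pair is `s = p`, `r = p^*`. For `p ≥ N` the gradient exponent is lowered to an
`s < N` with `1/s = 1/N + 1/r` and `r = q + 1`; both terms are at most `1/2`, whence `s ≥ 1`. -/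
theorem exists_sobolev_exponents (hN : 2 ≤ N) (hp : 1 < p) (hpq : p ≤ q)
    (hq : IsSubcritical N p q) :
    ∃ r s : ℝ, q < r ∧ 1 ≤ s ∧ s < N ∧ s ≤ p ∧ s⁻¹ - (N : ℝ)⁻¹ ≤ r⁻¹ := by
  have hN' : (2 : ℝ) ≤ N := by exact_mod_cast hN
  rcases lt_or_ge p (N : ℝ) with h | h
  · refine ⟨N * p / (N - p), p, hq h, hp.le, h, le_rfl, le_of_eq ?_⟩
    have : (N : ℝ) - p ≠ 0 := by linarith
    field_simp
  · have hi : (N : ℝ)⁻¹ ≤ 2⁻¹ := inv_anti₀ (by norm_num) hN'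
    have hi0 : 0 < (N : ℝ)⁻¹ := by positivity
    have hr : (q + 1)⁻¹ ≤ 2⁻¹ := inv_anti₀ (by norm_num) (by linarith)
    have hr0 : 0 < (q + 1)⁻¹ := inv_pos.2 (by linarith)
    refine ⟨q + 1, ((N : ℝ)⁻¹ + (q + 1)⁻¹)⁻¹, by linarith, ?_, ?_, ?_, ?_⟩
    · exact (one_le_inv₀ (by linarith)).2 (by linarith)
    · exact inv_lt_of_inv_lt₀ (by linarith) (by linarith)
    · refine le_trans (le_of_lt ?_) h
      exact inv_lt_of_inv_lt₀ (by linarith) (by linarith)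
    · rw [inv_inv]
      linarith

theorem eLpNorm_le_mul_of_support_subset_ball {F : Type*} [NormedAddCommGroup F] {a b : ℝ}
    (hab : a ≤ b) {ρ : ℝ} {g : RN N → F} (hg : AEStronglyMeasurable g volume)
    (hs : g.support ⊆ Metric.closedBall 0 ρ) :
    eLpNorm g (ENNReal.ofReal a) volume ≤ eLpNorm g (ENNReal.ofReal b) volume *
      volume (Metric.closedBall (0 : RN N) ρ) ^
        (1 / (ENNReal.ofReal a).toReal - 1 / (ENNReal.ofReal b).toReal) := by
  rw [← eLpNorm_restrict_eq_of_support_subset hs,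
    ← eLpNorm_restrict_eq_of_support_subset (p := ENNReal.ofReal b) hs,
    ← Measure.restrict_apply_univ (μ := volume) (Metric.closedBall (0 : RN N) ρ)]
  exact eLpNorm_le_eLpNorm_mul_rpow_measure_univ (ENNReal.ofReal_le_ofReal hab) hg.restrict

theorem volume_closedBall_rpow_ne_top {a b : ℝ} (ha : 0 < a) (hab : a ≤ b) (ρ : ℝ) :
    volume (Metric.closedBall (0 : RN N) ρ) ^
      (1 / (ENNReal.ofReal a).toReal - 1 / (ENNReal.ofReal b).toReal) ≠ ⊤ := by
  refine ENNReal.rpow_ne_top_of_nonneg ?_ measure_closedBall_lt_top.ne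
  rw [ENNReal.toReal_ofReal ha.le, ENNReal.toReal_ofReal (ha.le.trans hab)]
  exact sub_nonneg.2 (one_div_le_one_div_of_le ha hab)

/-- Gagliardo-Nirenberg-Sobolev with gradient exponent `s`, then Hölder on the ball to pass from `s`
to `p`. The strict inequality `q < r` leaves room to interpolate. -/
theorem exists_sobolev_constant_ball (hN : 2 ≤ N) (hp : 1 < p) (hpq : p ≤ q)
    (hq : IsSubcritical N p q) :
    ∃ r, q < r ∧ ∀ ρ : ℝ, ∃ C : ℝ≥0∞, C ≠ ⊤ ∧ ∀ f : RN N → ℝ, ContDiff ℝ 1 f →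
      f.support ⊆ Metric.ball 0 ρ →
      eLpNorm f (ENNReal.ofReal r) volume ≤
        C * eLpNorm (fderiv ℝ f) (ENNReal.ofReal p) volume := by
  obtain ⟨r, s, hr, hs1, hsN, hsp, hsr⟩ := exists_sobolev_exponents hN hp hpq hq
  refine ⟨r, hr, fun ρ => ?_⟩
  have hs0 : 0 < s := by linarith
  have hr0 : 0 < r := by linarith
  refine ⟨eLpNormLESNormFDerivOfLeConst ℝ (volume : Measure (RN N)) (Metric.ball (0 : RN N) ρ)
    s.toNNReal r.toNNReal * volume (Metric.closedBall (0 : RN N) ρ) ^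
      (1 / (ENNReal.ofReal s).toReal - 1 / (ENNReal.ofReal p).toReal),
    ENNReal.mul_ne_top ENNReal.coe_ne_top (volume_closedBall_rpow_ne_top hs0 hsp ρ),
    fun f hf hfs => ?_⟩
  have h1 := eLpNorm_le_eLpNorm_fderiv_of_le (volume : Measure (RN N)) (p := s.toNNReal)
    (q := r.toNNReal) hf hfs (by simpa using hs1)
    (by rw [finrank_euclideanSpace_fin]; exact Real.toNNReal_lt_natCast'.2 ⟨hsN, by omega⟩)
    (by
      rw [finrank_euclideanSpace_fin, NNReal.coe_inv, Real.coe_toNNReal _ hs0.le,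
        Real.coe_toNNReal _ hr0.le]
      exact hsr) Metric.isBounded_ball
  refine h1.trans ?_
  rw [mul_assoc]
  gcongr
  rw [mul_comm]
  refine eLpNorm_le_mul_of_support_subset_ball hsp
    (hf.continuous_fderiv (by simp)).aestronglyMeasurable ?_
  exact (support_fderiv_subset ℝ).trans
    (closure_minimal (hfs.trans Metric.ball_subset_closedBall) Metric.isClosed_closedBall)

theorem exists_subcritical_sobolev_constant_ball (hN : 2 ≤ N) (hp : 1 < p) (hpq : p ≤ q)
    (hq : IsSubcritical N p q) (ρ : ℝ) :
    ∃ C : ℝ≥0∞, C ≠ ⊤ ∧ ∀ f : RN N → ℝ, ContDiff ℝ 1 f → f.support ⊆ Metric.ball 0 ρ →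
      eLpNorm f (ENNReal.ofReal q) volume ≤
        C * eLpNorm (fderiv ℝ f) (ENNReal.ofReal p) volume := by
  obtain ⟨r, hr, h⟩ := exists_sobolev_constant_ball hN hp hpq hq
  obtain ⟨C, hC, hCf⟩ := h ρ
  have hq0 : 0 < q := by linarith
  refine ⟨_, ENNReal.mul_ne_top hC (volume_closedBall_rpow_ne_top (N := N) hq0 hr.le ρ),
    fun f hf hfs => ?_⟩
  refine (eLpNorm_le_mul_of_support_subset_ball hr.le hf.continuous.aestronglyMeasurable
    (hfs.trans Metric.ball_subset_closedBall)).trans ?_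
  rw [mul_right_comm]
  gcongr
  exact hCf f hf hfs

/-- Rellich-Kondrachov: a sequence of functions supported in a fixed ball, bounded in `W^{1,p}` and
with vanishing local means, converges to zero in `L^q` for every subcritical `q ≥ p`. -/
theorem tendsto_eLpNorm_subcritical_zero_of_setAverage (hN : 2 ≤ N) (hp : 1 < p) (hpq : p ≤ q)
    (hq : IsSubcritical N p q) {w : ℕ → RN N → ℝ} (hw : ∀ n, ContDiff ℝ 1 (w n)) {ρ : ℝ}
    (hs : ∀ n, (w n).support ⊆ Metric.ball 0 ρ) {D : ℝ≥0∞} (hD : D ≠ ⊤)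
    (hwD : ∀ n, eLpNorm (w n) (ENNReal.ofReal p) volume ≤ D)
    (hgD : ∀ n, eLpNorm (fderiv ℝ (w n)) (ENNReal.ofReal p) volume ≤ D)
    (hav : ∀ x : RN N, ∀ r : ℝ, 0 < r →
      Tendsto (fun n => ⨍ y in Metric.ball x r, w n y) atTop (𝓝 0)) :
    Tendsto (fun n => eLpNorm (w n) (ENNReal.ofReal q) volume) atTop (𝓝 0) := by
  have hp0 : 0 < p := by linarith
  have hq0 : 0 < q := by linarith
  have h1 := tendsto_eLpNorm_zero_of_setAverage hw hp.le hs hD hwD hgD hav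
  obtain ⟨r, hr, h⟩ := exists_sobolev_constant_ball hN hp hpq hq
  obtain ⟨C, hC, hCf⟩ := h ρ
  have hr0 : 0 < r := by linarith
  have hrp : 0 < r - p := by linarith
  -- The weights that write `q` as a convex combination of `p` and `r`. Since `q < r`, the vanishing
  -- `L^p` factor keeps a positive power.
  set a := (r - q) / (r - p) with ha
  set b := (q - p) / (r - p) with hb
  have ha0 : 0 < a := div_pos (by linarith) hrp
  have hb0 : 0 ≤ b := div_nonneg (by linarith) hrp.le
  have hab : a + b = 1 := by
    rw [ha, hb]
    field_simp
    ring
  have habq : a * p + b * r = q := by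
    rw [ha, hb]
    field_simp
    ring
  have hCD : ((C * D) ^ r) ^ b ≠ ⊤ := ENNReal.rpow_ne_top_of_nonneg hb0
    (ENNReal.rpow_ne_top_of_nonneg hr0.le (ENNReal.mul_ne_top hC hD))
  have h2 : Tendsto (fun n => (eLpNorm (w n) (ENNReal.ofReal p) volume ^ p) ^ a *
      ((C * D) ^ r) ^ b) atTop (𝓝 0) := by
    have := ENNReal.Tendsto.mul_const (b := ((C * D) ^ r) ^ b)
      ((h1.ennrpow_const p).ennrpow_const a) (Or.inr hCD)
    rwa [ENNReal.zero_rpow_of_pos hp0, ENNReal.zero_rpow_of_pos ha0, zero_mul] at this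
  have h3 : Tendsto (fun n => eLpNorm (w n) (ENNReal.ofReal q) volume ^ q) atTop (𝓝 0) := by
    refine tendsto_of_tendsto_of_tendsto_of_le_of_le tendsto_const_nhds h2 (fun _ => zero_le)
      fun n => ?_
    refine (eLpNorm_rpow_le_mul_of_convex_combination hp0 hq0 hr0 ha0.le hb0 hab habq
      (hw n).continuous.aestronglyMeasurable).trans ?_
    gcongr
    exact (hCf _ (hw n) (hs n)).trans (by gcongr; exact hgD n)
  have h4 := h3.ennrpow_const q⁻¹
  rw [ENNReal.zero_rpow_of_pos (inv_pos.2 hq0)] at h4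
  refine h4.congr fun n => ?_
  rw [← ENNReal.rpow_mul, mul_inv_cancel₀ hq0.ne', ENNReal.rpow_one]

end Sobolev

/-! ### Cutoff functions with small gradient -/

section Cutoff

/-- There are smooth cutoff functions with arbitrarily small gradient that are equal to one on a
given ball. -/
theorem exists_cutoff (K : ℝ) {ε : ℝ} (hε : 0 < ε) :
    ∃ χ : RN N → ℝ, ContDiff ℝ ∞ χ ∧ (∀ x, 0 ≤ χ x ∧ χ x ≤ 1) ∧
      (∃ ρ, χ.support ⊆ Metric.ball 0 ρ) ∧ (∀ x ∈ Metric.ball (0 : RN N) K, χ x = 1) ∧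
      ∀ x, ‖fderiv ℝ χ x‖ ≤ ε := by
  let b : ContDiffBump (0 : RN N) := ⟨1, 2, by norm_num, by norm_num⟩
  obtain ⟨L, hL⟩ := ((b.contDiff (n := ⊤)).continuous_fderiv
    (by simp)).bounded_above_of_compact_support (b.hasCompactSupport.fderiv ℝ)
  -- Dilating a fixed bump by `k` divides its gradient bound `L` by `k` and makes it one on the ball
  -- of radius `k`; the maximum with `1` keeps `k` positive.
  set k := max (max K (L / ε)) 1 with hk
  have hk0 : 0 < k := lt_of_lt_of_le one_pos (le_max_right _ _)
  have hKk : K ≤ k := (le_max_left _ _).trans (le_max_left _ _)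
  have hLk : L / ε ≤ k := (le_max_right _ _).trans (le_max_left _ _)
  refine ⟨fun x => b (k⁻¹ • x), b.contDiff.comp (contDiff_id.const_smul _),
    fun x => ⟨b.nonneg, b.le_one⟩, ⟨2 * k, fun x hx => ?_⟩, fun x hx => ?_, fun x => ?_⟩
  · have h1 : k⁻¹ • x ∈ Metric.ball (0 : RN N) 2 := by
      rw [← show b.rOut = 2 from rfl, ← b.support_eq]
      exact hx
    rw [mem_ball_zero_iff, norm_smul, Real.norm_of_nonneg (inv_nonneg.2 hk0.le),
      inv_mul_lt_iff₀ hk0] at h1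
    rw [mem_ball_zero_iff]
    linarith
  · refine b.one_of_mem_closedBall ?_
    rw [mem_ball_zero_iff] at hx
    rw [mem_closedBall_zero_iff, norm_smul, Real.norm_of_nonneg (inv_nonneg.2 hk0.le),
      inv_mul_le_iff₀ hk0]
    change ‖x‖ ≤ k * 1
    linarith
  · rw [fderiv_comp_smul, norm_smul, Real.norm_of_nonneg (inv_nonneg.2 hk0.le),
      inv_mul_le_iff₀ hk0]
    exact (hL _).trans ((div_le_iff₀ hε).1 hLk)

theorem eLpNorm_fderiv_mul_le {η f : RN N → ℝ} (hη : ContDiff ℝ 1 η) (hf : ContDiff ℝ 1 f)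
    (hη1 : ∀ x, |η x| ≤ 1) {ε : ℝ} (hηε : ∀ x, ‖fderiv ℝ η x‖ ≤ ε) {p : ℝ} (hp : 1 ≤ p) :
    eLpNorm (fderiv ℝ fun x => η x * f x) (ENNReal.ofReal p) volume ≤
      eLpNorm (fderiv ℝ f) (ENNReal.ofReal p) volume +
        ENNReal.ofReal ε * eLpNorm f (ENNReal.ofReal p) volume := by
  have h1 : (fderiv ℝ fun x => η x * f x) =
      (fun x => η x • fderiv ℝ f x) + fun x => f x • fderiv ℝ η x := by
    ext1 x
    exact fderiv_fun_mul (hη.differentiable (by simp) x) (hf.differentiable (by simp) x)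
  rw [h1]
  have hcη := hη.continuous_fderiv (by simp)
  have hcf := hf.continuous_fderiv (by simp)
  refine (eLpNorm_add_le (hη.continuous.smul hcf).aestronglyMeasurable
    (hf.continuous.smul hcη).aestronglyMeasurable (by simpa using hp)).trans ?_
  gcongr
  · refine eLpNorm_mono fun x => ?_
    rw [Pi.smul_apply', norm_smul]
    exact mul_le_of_le_one_left (norm_nonneg _) (hη1 x)
  · refine eLpNorm_le_mul_eLpNorm_of_ae_le_mul (Eventually.of_forall fun x => ?_) _
    rw [Pi.smul_apply', norm_smul, mul_comm]
    gcongr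
    exact hηε x

theorem eLpNorm_mul_le_of_abs_le_one {η f : RN N → ℝ} (hη1 : ∀ x, |η x| ≤ 1) (p : ℝ≥0∞) :
    eLpNorm (fun x => η x * f x) p volume ≤ eLpNorm f p volume := by
  refine eLpNorm_mono fun x => ?_
  rw [norm_mul]
  exact mul_le_of_le_one_left (norm_nonneg _) (hη1 x)

end Cutoff

/-! ### Weak convergence in normed spaces -/

/-- Weakly convergent sequences are bounded. -/
theorem exists_enorm_le_of_weak {E : Type*} [NormedAddCommGroup E] [NormedSpace ℝ E]
    {u : ℕ → E} {v : E} (h : ∀ l : E →L[ℝ] ℝ, Tendsto (fun n => l (u n)) atTop (𝓝 (l v))) :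
    ∃ B : ℝ≥0∞, B ≠ ⊤ ∧ ∀ n, ‖u n‖ₑ ≤ B := by
  have hg : ∀ l : StrongDual ℝ E, ∃ C, ∀ n,
      ‖NormedSpace.inclusionInDoubleDual ℝ E (u n) l‖ ≤ C := fun l => by
    obtain ⟨C, hC⟩ := (h l).norm.bddAbove_range
    exact ⟨C, fun n => hC (Set.mem_range_self n)⟩
  -- Uniform boundedness on the dual, which is complete whether or not `E` is; the embedding in the
  -- bidual is isometric.
  obtain ⟨C, hC⟩ := banach_steinhaus hg
  refine ⟨ENNReal.ofReal C, ENNReal.ofReal_ne_top, fun n => ?_⟩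
  rw [← ofReal_norm, ← (NormedSpace.inclusionInDoubleDualLi (E := E) ℝ).norm_map]
  exact ENNReal.ofReal_le_ofReal (hC n)

theorem enorm_le_enorm_sub_add {E : Type*} [NormedAddCommGroup E] (x y : E) :
    ‖x‖ₑ ≤ ‖x - y‖ₑ + ‖y‖ₑ := by
  simpa using enorm_add_le (x - y) y

theorem enorm_sub_le_add_of_le {E : Type*} [NormedAddCommGroup E] {x y : E} {a b : ℝ≥0∞}
    (hx : ‖x‖ₑ ≤ a) (hy : ‖y‖ₑ ≤ b) : ‖x - y‖ₑ ≤ a + b :=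
  enorm_sub_le.trans (add_le_add hx hy)

theorem tendsto_apply_sub_of_weak {E : Type*} [NormedAddCommGroup E] [NormedSpace ℝ E]
    {u a b : ℕ → E} {v : E}
    (huv : ∀ l : E →L[ℝ] ℝ, Tendsto (fun n => l (u n)) atTop (𝓝 (l v)))
    (ha : Tendsto (fun n => a n - u n) atTop (𝓝 0)) (hb : Tendsto b atTop (𝓝 v))
    (l : E →L[ℝ] ℝ) : Tendsto (fun n => l (a n - b n)) atTop (𝓝 0) := by
  have h1 := (l.continuous.tendsto 0).comp ha
  have h2 := (l.continuous.tendsto v).comp hb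
  have h := (h1.add (huv l)).sub h2
  rw [map_zero, zero_add, sub_self] at h
  refine h.congr fun n => ?_
  simp

/-! ### The estimates for test functions -/

section TestFunctions

variable {Ω : Opens (RN N)} {p q : ℝ}

theorem tendsto_ofReal_one_div_add_one :
    Tendsto (fun n : ℕ => ENNReal.ofReal (1 / ((n : ℝ) + 1))) atTop (𝓝 0) := by
  simpa using ENNReal.tendsto_ofReal (tendsto_one_div_add_atTop_nhds_zero_nat (𝕜 := ℝ))

theorem tendsto_inv_volume_ball_rpow (hN : N ≠ 0) (hp : 0 < p) :
    Tendsto (fun n : ℕ => (volume (Metric.ball (0 : RN N) ((n : ℝ) + 1)))⁻¹ ^ p⁻¹) atTop (𝓝 0) := by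
  have h1 : Tendsto (fun n : ℕ => (volume (Metric.ball (0 : RN N) ((n : ℝ) + 1)))⁻¹) atTop
      (𝓝 0) := by
    rw [← ENNReal.inv_top]
    refine tendsto_inv_iff.2 ?_
    have h2 : ∀ n : ℕ, volume (Metric.ball (0 : RN N) ((n : ℝ) + 1)) =
        ENNReal.ofReal (((n : ℝ) + 1) ^ N) * volume (Metric.ball (0 : RN N) 1) := fun n => by
      rw [Measure.addHaar_ball_of_pos _ _ (by positivity), finrank_euclideanSpace_fin]
    simp only [h2]
    rw [← ENNReal.top_mul (Metric.measure_ball_pos volume (0 : RN N) one_pos).ne']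
    refine ENNReal.Tendsto.mul_const (ENNReal.tendsto_ofReal_atTop.comp ?_)
      (Or.inl ENNReal.top_ne_zero)
    exact (tendsto_pow_atTop hN).comp
      (tendsto_atTop_add_const_right _ _ tendsto_natCast_atTop_atTop)
  simpa [ENNReal.zero_rpow_of_pos (inv_pos.2 hp)] using h1.ennrpow_const p⁻¹

theorem norm_gradient_eq_norm_fderiv (f : RN N → ℝ) (x : RN N) : ‖∇ f x‖ = ‖fderiv ℝ f x‖ :=
  (InnerProductSpace.toDual ℝ (RN N)).symm.norm_map _

theorem normLq_eq_eLpNorm_volume {f : RN N → ℝ} (hf : tsupport f ⊆ (Ω : Set (RN N))) :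
    normLq Ω q f = eLpNorm f (ENNReal.ofReal q) volume :=
  eLpNorm_restrict_eq_of_support_subset ((subset_tsupport f).trans hf)

theorem eLpNorm_gradient_eq_eLpNorm_fderiv {f : RN N → ℝ} (hf : tsupport f ⊆ (Ω : Set (RN N)))
    (r : ℝ≥0∞) :
    eLpNorm (∇ f) r (volume.restrict (Ω : Set (RN N))) = eLpNorm (fderiv ℝ f) r volume := by
  rw [← eLpNorm_restrict_eq_of_support_subset (f := fderiv ℝ f)
    ((support_fderiv_subset ℝ).trans hf)]
  exact eLpNorm_congr_norm_ae (Eventually.of_forall (norm_gradient_eq_norm_fderiv f))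

theorem energy_eq_eLpNorm_rpow (hp : 0 < p) (g : RN N → RN N) :
    energy Ω p g = eLpNorm g (ENNReal.ofReal p) (volume.restrict (Ω : Set (RN N))) ^ p :=
  lintegral_enorm_rpow_eq_eLpNorm_rpow hp g

/-- By homogeneity: `ψ` divided by its norm competes in the infimum. When the norm is zero, the left
side is zero even if the constant is `∞`. -/
theorem poincareSobolev_mul_normLq_rpow_le (hp : 0 < p) (ψ : 𝓓(Ω, ℝ)) :
    poincareSobolev Ω p q * normLq Ω q ψ ^ p ≤ energy Ω p (∇ (ψ : RN N → ℝ)) := by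
  set c := normLq Ω q ψ with hc
  rcases eq_or_ne c 0 with h0 | h0
  · rw [h0, ENNReal.zero_rpow_of_pos hp, mul_zero]
    exact zero_le
  have ht : c ≠ ⊤ := (testFunction_memLp ψ _ _).eLpNorm_lt_top.ne
  have hc0 : 0 < c.toReal := ENNReal.toReal_pos h0 ht
  have hce : ‖c.toReal⁻¹‖ₑ = c⁻¹ := by
    rw [enorm_inv hc0.ne', Real.enorm_of_nonneg hc0.le, ENNReal.ofReal_toReal ht]
  have h1 : normLq Ω q (c.toReal⁻¹ • ψ : 𝓓(Ω, ℝ)) = 1 := by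
    rw [normLq, FunLike.coe_smul, eLpNorm_const_smul, hce]
    exact ENNReal.inv_mul_cancel h0 ht
  have h2 : poincareSobolev Ω p q ≤
      energy Ω p (∇ ((c.toReal⁻¹ • ψ : 𝓓(Ω, ℝ)) : RN N → ℝ)) := 
    iInf₂_le (c.toReal⁻¹ • ψ : 𝓓(Ω, ℝ)) h1
  have h3 : energy Ω p (∇ ((c.toReal⁻¹ • ψ : 𝓓(Ω, ℝ)) : RN N → ℝ)) =
      (c⁻¹) ^ p * energy Ω p (∇ (ψ : RN N → ℝ)) := by
    have h4 : ∇ ((c.toReal⁻¹ • ψ : 𝓓(Ω, ℝ)) : RN N → ℝ) = c.toReal⁻¹ • ∇ (ψ : RN N → ℝ) := by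
      ext1 x
      rw [FunLike.coe_smul, Pi.smul_apply, gradient,
        fderiv_const_smul (ψ.contDiff.differentiable (by simp) x), map_smul]
      rfl
    rw [energy_eq_eLpNorm_rpow hp, energy_eq_eLpNorm_rpow hp, h4, eLpNorm_const_smul, hce,
      ENNReal.mul_rpow_of_nonneg _ _ hp.le]
  rw [h3] at h2
  calc poincareSobolev Ω p q * c ^ p
      ≤ (c⁻¹) ^ p * energy Ω p (∇ (ψ : RN N → ℝ)) * c ^ p := by gcongr
    _ = energy Ω p (∇ (ψ : RN N → ℝ)) := by
        rw [mul_right_comm, ← ENNReal.mul_rpow_of_nonneg _ _ hp.le,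
          ENNReal.inv_mul_cancel h0 ht, ENNReal.one_rpow, one_mul]

/-- The Poincaré-Sobolev inequality outside of a ball, for a test function multiplied by a cutoff
that vanishes near the ball. -/
theorem rpow_mul_eLpNorm_cutoff_le (hp : 1 ≤ p) {R K ε : ℝ} (hRK : R < K) {t : ℝ≥0∞}
    (ht : t ≤ poincareSobolev (removeBall Ω R) p q) {η : RN N → ℝ} (hη : ContDiff ℝ ∞ η)
    (hη1 : ∀ x, |η x| ≤ 1) (hη0 : ∀ x ∈ Metric.ball (0 : RN N) K, η x = 0)
    (hηε : ∀ x, ‖fderiv ℝ η x‖ ≤ ε) (φ : 𝓓(Ω, ℝ)) :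
    t ^ p⁻¹ * eLpNorm (fun x => η x * φ x) (ENNReal.ofReal q) volume ≤
      eLpNorm (fderiv ℝ φ) (ENNReal.ofReal p) volume +
        ENNReal.ofReal ε * eLpNorm φ (ENNReal.ofReal p) volume := by
  have hp0 : 0 < p := by linarith
  have hηs : tsupport η ⊆ (Metric.ball (0 : RN N) K)ᶜ := by
    refine closure_minimal (fun x hx hxK => hx (hη0 x hxK)) Metric.isOpen_ball.isClosed_compl
  -- The gap `R < K` keeps the closed support of `η φ` off the closure of `B_R`, so the product is
  -- admissible in the exterior domain.
  let ψ : 𝓓(removeBall Ω R, ℝ) :=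
    { toFun := fun x => η x * φ x
      contDiff' := hη.mul φ.contDiff
      hasCompactSupport' := φ.hasCompactSupport.mul_left
      tsupport_subset' := fun x hx => ⟨φ.tsupport_subset (tsupport_mul_subset_right hx), fun hxR => by
        refine hηs (tsupport_mul_subset_left hx) ?_
        exact Metric.closedBall_subset_ball hRK (Metric.closure_ball_subset_closedBall hxR)⟩ }
  have h := poincareSobolev_mul_normLq_rpow_le (p := p) (q := q) hp0 ψ
  rw [energy_eq_eLpNorm_rpow hp0, normLq_eq_eLpNorm_volume ψ.tsupport_subset,
    eLpNorm_gradient_eq_eLpNorm_fderiv ψ.tsupport_subset] at h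
  have h1 : t * eLpNorm ψ (ENNReal.ofReal q) volume ^ p ≤
      eLpNorm (fderiv ℝ ψ) (ENNReal.ofReal p) volume ^ p := le_trans (by gcongr) h
  refine le_trans ?_ (eLpNorm_fderiv_mul_le (hη.of_le (by simp)) (φ.contDiff.of_le (by simp)) hη1
    hηε hp)
  rw [← ENNReal.rpow_le_rpow_iff hp0, ENNReal.mul_rpow_of_nonneg _ _ hp0.le, ← ENNReal.rpow_mul,
    inv_mul_cancel₀ hp0.ne', ENNReal.rpow_one]
  exact h1

theorem exists_lt_poincareSobolev_removeBall {t : ℝ≥0∞} (ht : t < poincareSobolevInfty Ω p q) :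
    ∃ R, t < poincareSobolev (removeBall Ω R) p q := by
  simp only [poincareSobolevInfty, lt_iSup_iff] at ht
  obtain ⟨R, -, h⟩ := ht
  exact ⟨R, h⟩

theorem eLpNorm_le_cutoff_add {η χ f : RN N → ℝ} (hη : Continuous η) (hχ : Continuous χ)
    (hf : Continuous f) (h : ∀ x, η x + χ x = 1) {r : ℝ≥0∞} (hr : 1 ≤ r) :
    eLpNorm f r volume ≤
      eLpNorm (fun x => η x * f x) r volume + eLpNorm (fun x => χ x * f x) r volume := by
  refine le_trans (le_of_eq ?_) (eLpNorm_add_le (hη.mul hf).aestronglyMeasurable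
    (hχ.mul hf).aestronglyMeasurable hr)
  congr 1
  ext x
  change f x = η x * f x + χ x * f x
  rw [← add_mul, h, one_mul]

/-- A partition of unity by a cutoff `χ` of a large ball and its complement `η`, with small
gradients. -/
theorem exists_cutoff_pair (K : ℝ) {ε : ℝ} (hε : 0 < ε) :
    ∃ η χ : RN N → ℝ, ContDiff ℝ ∞ η ∧ ContDiff ℝ ∞ χ ∧ (∀ x, η x + χ x = 1) ∧
      (∀ x, |η x| ≤ 1) ∧ (∀ x, |χ x| ≤ 1) ∧ (∃ ρ, χ.support ⊆ Metric.ball 0 ρ) ∧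
      (∀ x ∈ Metric.ball (0 : RN N) K, η x = 0) ∧ (∀ x, ‖fderiv ℝ η x‖ ≤ ε) ∧
      ∀ x, ‖fderiv ℝ χ x‖ ≤ ε := by
  obtain ⟨χ, h1, h2, h3, h4, h5⟩ := exists_cutoff (N := N) K hε
  refine ⟨fun x => 1 - χ x, χ, contDiff_const.sub h1, h1, fun x => by ring,
    fun x => abs_le.2 ⟨by linarith [(h2 x).2], by linarith [(h2 x).1]⟩,
    fun x => abs_le.2 ⟨by linarith [(h2 x).1], (h2 x).2⟩, h3, fun x hx => by simp [h4 x hx],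
    fun x => ?_, h5⟩
  rw [fderiv_const_sub, norm_neg]
  exact h5 x

/-- If the Poincaré-Sobolev constant at infinity is positive, the Sobolev embedding holds. -/
theorem exists_sobolev_constant_of_poincareSobolevInfty_pos (hN : 2 ≤ N) (hp : 1 < p) (hpq : p ≤ q)
    (hq : IsSubcritical N p q) (hE : 0 < poincareSobolevInfty Ω p q) :
    ∃ C : ℝ≥0∞, C ≠ ⊤ ∧ ∀ φ : 𝓓(Ω, ℝ), eLpNorm φ (ENNReal.ofReal q) volume ≤
      C * (eLpNorm (fderiv ℝ φ) (ENNReal.ofReal p) volume +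
        eLpNorm φ (ENNReal.ofReal p) volume) := by
  have hp0 : 0 < p := by linarith
  obtain ⟨t, ht0, htE⟩ := exists_between hE
  obtain ⟨R, hR⟩ := exists_lt_poincareSobolev_removeBall htE
  obtain ⟨η, χ, hη, hχ, hsum, hη1, hχ1, ⟨ρ, hρ⟩, hη0, hηε, hχε⟩ :=
    -- Any gradient bound would do here: the right side already contains `‖φ‖_p`.
    exists_cutoff_pair (N := N) (R + 1) one_pos
  obtain ⟨C, hC, hCf⟩ := exists_subcritical_sobolev_constant_ball hN hp hpq hq ρ
  have htt : t ≠ ⊤ := htE.ne_top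
  have ht0' : t ^ p⁻¹ ≠ 0 := by simp [ENNReal.rpow_eq_zero_iff, ht0.ne', htt]
  have htt' : t ^ p⁻¹ ≠ ⊤ := ENNReal.rpow_ne_top_of_nonneg (inv_nonneg.2 hp0.le) htt
  refine ⟨(t ^ p⁻¹)⁻¹ + C, ENNReal.add_ne_top.2 ⟨ENNReal.inv_ne_top.2 ht0', hC⟩, fun φ => ?_⟩
  have h1 := rpow_mul_eLpNorm_cutoff_le hp.le (lt_add_one R) hR.le hη hη1 hη0 hηε φ
  have hφ : ContDiff ℝ 1 φ := φ.contDiff.of_le (by simp)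
  have h2 := hCf (fun x => χ x * φ x) ((hχ.of_le (by simp)).mul hφ) fun x hx =>
    hρ (left_ne_zero_of_mul hx)
  have h3 := eLpNorm_fderiv_mul_le (hχ.of_le (by simp)) hφ hχ1 hχε hp.le
  rw [ENNReal.ofReal_one, one_mul] at h1 h3
  refine (eLpNorm_le_cutoff_add hη.continuous hχ.continuous φ.continuous hsum
    (by simpa using hp.le.trans hpq)).trans ?_
  rw [add_mul]
  gcongr
  · rwa [← ENNReal.mul_le_iff_le_inv ht0' htt']
  · exact h2.trans (by gcongr)

/-- The core splitting: `a n` stands for `u_n` and `b n` for the weak limit, with `γ` and `δ` the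
approximation errors in `L^q` and in the gradient. The part `η a n` is paid for by the gradient, and
`χ a n` is compared with `χ b n`, whose norm is at most `U + γ n`. -/
theorem rpow_le_add_of_testFunction {t m D U : ℝ≥0∞} {R ε : ℝ} (hε : 0 < ε) (hp : 1 ≤ p)
    (hq : 1 ≤ q) (ht : t ≠ ⊤) (hR : t ≤ poincareSobolev (removeBall Ω R) p q) {a b : ℕ → 𝓓(Ω, ℝ)}
    {δ γ : ℕ → ℝ≥0∞} (hδ : Tendsto δ atTop (𝓝 0)) (hγ : Tendsto γ atTop (𝓝 0))
    (ha : ∀ n, 1 ≤ eLpNorm (a n) (ENNReal.ofReal q) volume + γ n)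
    (hb : ∀ n, eLpNorm (b n) (ENNReal.ofReal q) volume ≤ U + γ n)
    (haD : ∀ n, eLpNorm (a n) (ENNReal.ofReal p) volume ≤ D)
    (ham : ∀ᶠ n in atTop, eLpNorm (fderiv ℝ (a n)) (ENNReal.ofReal p) volume ≤ m + δ n)
    (hab : ∀ χ : RN N → ℝ, ContDiff ℝ ∞ χ → (∀ x, |χ x| ≤ 1) → (∀ x, ‖fderiv ℝ χ x‖ ≤ ε) →
      (∃ ρ, χ.support ⊆ Metric.ball 0 ρ) →
      Tendsto (fun n => eLpNorm (fun x => χ x * (a n - b n : 𝓓(Ω, ℝ)) x) (ENNReal.ofReal q) volume)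
        atTop (𝓝 0)) :
    t ^ p⁻¹ ≤ m + ENNReal.ofReal ε * D + t ^ p⁻¹ * U := by
  have hτ : t ^ p⁻¹ ≠ ⊤ := ENNReal.rpow_ne_top_of_nonneg (inv_nonneg.2 (by linarith)) ht
  have hq' : 1 ≤ ENNReal.ofReal q := by simpa using hq
  obtain ⟨η, χ, hη, hχ, hsum, hη1, hχ1, hρ, hη0, hηε, hχε⟩ :=
    exists_cutoff_pair (N := N) (R + 1) hε
  have hs0 := hab χ hχ hχ1 hχε hρ
  set s : ℕ → ℝ≥0∞ := fun n =>
    eLpNorm (fun x => χ x * (a n - b n : 𝓓(Ω, ℝ)) x) (ENNReal.ofReal q) volume with hs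
  have hχa : ∀ n, eLpNorm (fun x => χ x * a n x) (ENNReal.ofReal q) volume ≤
      s n + (U + γ n) := fun n => by
    have hc : (fun x => χ x * a n x) =
        (fun x => χ x * (a n - b n : 𝓓(Ω, ℝ)) x) + fun x => χ x * b n x := by
      ext x
      simp only [Pi.add_apply, FunLike.coe_sub, Pi.sub_apply]
      ring
    rw [hc]
    refine (eLpNorm_add_le (hχ.continuous.mul (a n - b n).continuous).aestronglyMeasurable
      (hχ.continuous.mul (b n).continuous).aestronglyMeasurable hq').trans ?_
    exact add_le_add le_rfl ((eLpNorm_mul_le_of_abs_le_one hχ1 _).trans (hb n))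
  have hηa : ∀ᶠ n in atTop, t ^ p⁻¹ * eLpNorm (fun x => η x * a n x) (ENNReal.ofReal q) volume ≤
      (m + δ n) + ENNReal.ofReal ε * D := ham.mono fun n hn =>
    (rpow_mul_eLpNorm_cutoff_le hp (lt_add_one R) hR hη hη1 hη0 hηε (a n)).trans
      (add_le_add hn (mul_le_mul_right (haD n) _))
  have hlim : Tendsto (fun n => (m + δ n) + ENNReal.ofReal ε * D +
      t ^ p⁻¹ * (s n + (U + γ n) + γ n)) atTop
      (𝓝 ((m + 0) + ENNReal.ofReal ε * D + t ^ p⁻¹ * (0 + (U + 0) + 0))) :=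
    ((hδ.const_add m).add_const _).add (ENNReal.Tendsto.const_mul
      ((hs0.add (hγ.const_add _)).add hγ) (Or.inr hτ))
  simp only [add_zero, zero_add] at hlim
  refine ge_of_tendsto hlim (hηa.mono fun n hn => ?_)
  calc t ^ p⁻¹ = t ^ p⁻¹ * 1 := (mul_one _).symm
    _ ≤ t ^ p⁻¹ * ((eLpNorm (fun x => η x * a n x) (ENNReal.ofReal q) volume +
          eLpNorm (fun x => χ x * a n x) (ENNReal.ofReal q) volume) + γ n) :=
        mul_le_mul_right ((ha n).trans (add_le_add (eLpNorm_le_cutoff_add hη.continuous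
          hχ.continuous (a n).continuous hsum hq') le_rfl)) _
    _ = t ^ p⁻¹ * eLpNorm (fun x => η x * a n x) (ENNReal.ofReal q) volume +
          t ^ p⁻¹ * (eLpNorm (fun x => χ x * a n x) (ENNReal.ofReal q) volume + γ n) := by ring
    _ ≤ _ := add_le_add hn (mul_le_mul_right (add_le_add (hχa n) le_rfl) _)

end TestFunctions

/-! ### Passage from test functions to `W^{1,p}_0` -/

namespace W1p

variable {Ω : Opens (RN N)} {p q : ℝ} [Fact (1 ≤ ENNReal.ofReal p)]

theorem enorm_eq_add (w : W1p Ω p) :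
    ‖w‖ₑ = eLpNorm (fn w) (ENNReal.ofReal p) (volume.restrict (Ω : Set (RN N))) +
      eLpNorm (grad w) (ENNReal.ofReal p) (volume.restrict (Ω : Set (RN N))) := by
  have h : ‖w‖ = ‖(w : LpPair Ω p).fst‖ + ‖(w : LpPair Ω p).snd‖ := WithLp.prod_norm_eq_of_L1 _
  rw [← ofReal_norm, h, ENNReal.ofReal_add (norm_nonneg _) (norm_nonneg _), ofReal_norm,
    ofReal_norm, Lp.enorm_def, Lp.enorm_def]
  rfl

theorem eLpNorm_fn_le (w : W1p Ω p) :
    eLpNorm (fn w) (ENNReal.ofReal p) (volume.restrict (Ω : Set (RN N))) ≤ ‖w‖ₑ := by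
  rw [enorm_eq_add]
  exact le_self_add

theorem eLpNorm_grad_le (w : W1p Ω p) :
    eLpNorm (grad w) (ENNReal.ofReal p) (volume.restrict (Ω : Set (RN N))) ≤ ‖w‖ₑ := by
  rw [enorm_eq_add]
  exact le_add_self

theorem aestronglyMeasurable_fn (w : W1p Ω p) :
    AEStronglyMeasurable (fn w) (volume.restrict (Ω : Set (RN N))) :=
  Lp.aestronglyMeasurable _

theorem aestronglyMeasurable_grad (w : W1p Ω p) :
    AEStronglyMeasurable (grad w) (volume.restrict (Ω : Set (RN N))) :=
  Lp.aestronglyMeasurable _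

theorem fn_sub (v w : W1p Ω p) :
    fn (v - w) =ᵐ[volume.restrict (Ω : Set (RN N))] fn v - fn w :=
  Lp.coeFn_sub (v : LpPair Ω p).fst (w : LpPair Ω p).fst

theorem grad_sub (v w : W1p Ω p) :
    grad (v - w) =ᵐ[volume.restrict (Ω : Set (RN N))] grad v - grad w :=
  Lp.coeFn_sub (v : LpPair Ω p).snd (w : LpPair Ω p).snd

theorem fn_ofTestFunction (φ : 𝓓(Ω, ℝ)) :
    fn (ofTestFunction φ : W1p Ω p) =ᵐ[volume.restrict (Ω : Set (RN N))] φ :=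
  (testFunction_memLp φ _ _).coeFn_toLp

theorem grad_ofTestFunction (φ : 𝓓(Ω, ℝ)) :
    grad (ofTestFunction φ : W1p Ω p) =ᵐ[volume.restrict (Ω : Set (RN N))] ∇ (φ : RN N → ℝ) :=
  (testFunction_memLp_gradient φ _ _).coeFn_toLp

theorem eLpNorm_fn_ofTestFunction (φ : 𝓓(Ω, ℝ)) (r : ℝ) :
    eLpNorm (fn (ofTestFunction φ : W1p Ω p)) (ENNReal.ofReal r)
      (volume.restrict (Ω : Set (RN N))) = eLpNorm φ (ENNReal.ofReal r) volume := by
  rw [eLpNorm_congr_ae (fn_ofTestFunction φ)]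
  exact normLq_eq_eLpNorm_volume φ.tsupport_subset

theorem eLpNorm_grad_ofTestFunction (φ : 𝓓(Ω, ℝ)) (r : ℝ) :
    eLpNorm (grad (ofTestFunction φ : W1p Ω p)) (ENNReal.ofReal r)
      (volume.restrict (Ω : Set (RN N))) = eLpNorm (fderiv ℝ φ) (ENNReal.ofReal r) volume := by
  rw [eLpNorm_congr_ae (grad_ofTestFunction φ)]
  exact eLpNorm_gradient_eq_eLpNorm_fderiv φ.tsupport_subset _

theorem eLpNorm_testFunction_le_enorm (φ : 𝓓(Ω, ℝ)) :
    eLpNorm φ (ENNReal.ofReal p) volume ≤ ‖(ofTestFunction φ : W1p Ω p)‖ₑ := by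
  rw [← eLpNorm_fn_ofTestFunction (p := p)]
  exact eLpNorm_fn_le _

theorem eLpNorm_fderiv_testFunction_le_enorm (φ : 𝓓(Ω, ℝ)) :
    eLpNorm (fderiv ℝ φ) (ENNReal.ofReal p) volume ≤ ‖(ofTestFunction φ : W1p Ω p)‖ₑ := by
  rw [← eLpNorm_grad_ofTestFunction (p := p)]
  exact eLpNorm_grad_le _

theorem eLpNorm_fderiv_testFunction_le_add (φ : 𝓓(Ω, ℝ)) (w : W1p Ω p) :
    eLpNorm (fderiv ℝ φ) (ENNReal.ofReal p) volume ≤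
      eLpNorm (grad w) (ENNReal.ofReal p) (volume.restrict (Ω : Set (RN N))) +
        ‖ofTestFunction φ - w‖ₑ := by
  rw [← eLpNorm_grad_ofTestFunction (p := p), add_comm]
  have h := eLpNorm_add_le (aestronglyMeasurable_grad (ofTestFunction φ - w))
    (aestronglyMeasurable_grad w) (Fact.out : 1 ≤ ENNReal.ofReal p)
  refine le_trans (le_of_eq (eLpNorm_congr_ae ?_)) (h.trans (by gcongr; exact eLpNorm_grad_le _))
  filter_upwards [grad_sub (ofTestFunction φ) w] with x hx
  simp [hx]

theorem exists_testFunction_near {w : W1p Ω p} (hw : w ∈ W1p0 Ω p) (n : ℕ) :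
    ∃ φ : 𝓓(Ω, ℝ),
      ‖(ofTestFunction φ : W1p Ω p) - w‖ₑ ≤ ENNReal.ofReal (1 / ((n : ℝ) + 1)) := by
  obtain ⟨φ, hφ⟩ := Metric.mem_closure_range_iff_nat.1 hw n
  refine ⟨φ, ?_⟩
  rw [← ofReal_norm, ← dist_eq_norm, dist_comm]
  exact ENNReal.ofReal_le_ofReal hφ.le

theorem tendsto_of_enorm_sub_le {w : W1p Ω p} {v : ℕ → W1p Ω p}
    (h : ∀ n : ℕ, ‖v n - w‖ₑ ≤ ENNReal.ofReal (1 / ((n : ℝ) + 1))) :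
    Tendsto v atTop (𝓝 w) := by
  rw [tendsto_iff_edist_tendsto_0]
  refine tendsto_of_tendsto_of_tendsto_of_le_of_le tendsto_const_nhds
    tendsto_ofReal_one_div_add_one (fun _ => zero_le) fun n => ?_
  rw [edist_eq_enorm_sub]
  exact h n

theorem eLpNorm_fn_sub_le (v w : W1p Ω p) (ν : Measure (RN N))
    (hν : ν ≤ volume.restrict (Ω : Set (RN N))) :
    eLpNorm (fn v - fn w) (ENNReal.ofReal p) ν ≤ ‖v - w‖ₑ := by
  refine (eLpNorm_mono_measure _ hν).trans ?_
  rw [← eLpNorm_congr_ae (fn_sub v w)]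
  exact eLpNorm_fn_le _

/-- A bound of Lebesgue norms passes from test functions to their limits in `W^{1,p}`. -/
theorem eLpNorm_fn_le_of_testFunction {w : W1p Ω p} {φ : ℕ → 𝓓(Ω, ℝ)}
    (h : ∀ n : ℕ, ‖(ofTestFunction (φ n) : W1p Ω p) - w‖ₑ ≤ ENNReal.ofReal (1 / ((n : ℝ) + 1)))
    {ν : Measure (RN N)} (hν : ν ≤ volume.restrict (Ω : Set (RN N))) {r c : ℝ≥0∞} {b : ℕ → ℝ≥0∞}
    (hb : ∀ n, eLpNorm (φ n) r ν ≤ b n) (hbc : Tendsto b atTop (𝓝 c)) :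
    eLpNorm (fn w) r ν ≤ c := by
  have h1 : (1 : ℝ≥0∞) ≤ ENNReal.ofReal p := Fact.out
  refine eLpNorm_le_of_tendsto_eLpNorm_sub (p := ENNReal.ofReal p) (by positivity)
    (f := fun n => fn (ofTestFunction (φ n) : W1p Ω p))
    (fun n => (aestronglyMeasurable_fn _).mono_measure hν)
    ((aestronglyMeasurable_fn _).mono_measure hν) ?_ (b := b) (fun n => ?_) hbc
  · exact tendsto_of_tendsto_of_tendsto_of_le_of_le tendsto_const_nhds
      tendsto_ofReal_one_div_add_one (fun _ => zero_le)
      fun n => (eLpNorm_fn_sub_le _ _ ν hν).trans (h n)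
  · rw [eLpNorm_congr_ae (Measure.absolutelyContinuous_of_le hν |>.ae_le (fn_ofTestFunction (φ n)))]
    exact hb n

/-- Density, with lower semicontinuity of the `L^q` norm under `L^p` convergence. It makes `W^{1,p}`
approximation within `W^{1,p}_0` also an `L^q` approximation. -/
theorem exists_sobolev_constant (hN : 2 ≤ N) (hp : 1 < p) (hpq : p ≤ q)
    (hq : IsSubcritical N p q) (hE : 0 < poincareSobolevInfty Ω p q) :
    ∃ C : ℝ≥0∞, C ≠ ⊤ ∧ ∀ w ∈ W1p0 Ω p, normLq Ω q (fn w) ≤ C * ‖w‖ₑ := by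
  obtain ⟨C, hC, hCφ⟩ := exists_sobolev_constant_of_poincareSobolevInfty_pos hN hp hpq hq hE
  refine ⟨C, hC, fun w hw => ?_⟩
  choose φ hφ using exists_testFunction_near hw
  refine eLpNorm_fn_le_of_testFunction hφ le_rfl
    (b := fun n => C * ‖(ofTestFunction (φ n) : W1p Ω p)‖ₑ) (fun n => ?_) ?_
  · refine le_trans (le_of_eq (normLq_eq_eLpNorm_volume (φ n).tsupport_subset)) ?_
    refine (hCφ (φ n)).trans (le_of_eq ?_)
    rw [enorm_eq_add, eLpNorm_fn_ofTestFunction, eLpNorm_grad_ofTestFunction, add_comm]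
  · exact ENNReal.Tendsto.const_mul (tendsto_of_enorm_sub_le hφ).enorm (Or.inr hC)

/-- An element of `W^{1,p}_0` with vanishing gradient vanishes. -/
theorem fn_ae_eq_zero_of_grad (hN : N ≠ 0) (hp : 1 ≤ p) {w : W1p Ω p} (hw : w ∈ W1p0 Ω p)
    (hg : eLpNorm (grad w) (ENNReal.ofReal p) (volume.restrict (Ω : Set (RN N))) = 0) :
    fn w =ᵐ[volume.restrict (Ω : Set (RN N))] 0 := by
  have hp0 : 0 < p := by linarith
  choose φ hφ using exists_testFunction_near hw
  set V : ℝ → ℝ≥0∞ := fun ρ => volume (Metric.ball (0 : RN N) ρ) with hV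
  have hVt : ∀ ρ, V ρ ^ p⁻¹ ≠ ⊤ := fun ρ =>
    ENNReal.rpow_ne_top_of_nonneg (inv_nonneg.2 hp0.le) measure_ball_lt_top.ne
  -- Averaging at scale `k + 1`: along the approximating test functions the gradient term vanishes
  -- for fixed `k`. Sending `k → ∞` afterwards kills the rest, since the volume of the large ball
  -- tends to infinity.
  have key : ∀ (ρ : ℝ) (k : ℕ), eLpNorm (fn w) (ENNReal.ofReal p)
      ((volume.restrict (Ω : Set (RN N))).restrict (Metric.ball 0 ρ)) ≤
      V ρ ^ p⁻¹ * ((V ((k : ℝ) + 1))⁻¹ ^ p⁻¹ * ‖w‖ₑ) := by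
    intro ρ k
    have hk : (0 : ℝ) < (k : ℝ) + 1 := by positivity
    have hVk : (V ((k : ℝ) + 1))⁻¹ ^ p⁻¹ ≠ ⊤ :=
      ENNReal.rpow_ne_top_of_nonneg (inv_nonneg.2 hp0.le)
        (ENNReal.inv_ne_top.2 (Metric.measure_ball_pos _ _ hk).ne')
    refine eLpNorm_fn_le_of_testFunction hφ Measure.restrict_le_self
      (b := fun n => ENNReal.ofReal ((k : ℝ) + 1) * ENNReal.ofReal (1 / ((n : ℝ) + 1)) +
        V ρ ^ p⁻¹ * ((V ((k : ℝ) + 1))⁻¹ ^ p⁻¹ * ‖(ofTestFunction (φ n) : W1p Ω p)‖ₑ))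
      (fun n => ?_) ?_
    · refine (eLpNorm_mono_measure _ (Measure.restrict_mono_measure
        Measure.restrict_le_self _)).trans ?_
      refine (eLpNorm_restrict_ball_le ((φ n).contDiff.of_le (by simp)) hp hk ρ).trans ?_
      gcongr
      · have := eLpNorm_fderiv_testFunction_le_add (φ n) w
        rw [hg, zero_add] at this
        exact this.trans (hφ n)
      · exact eLpNorm_testFunction_le_enorm _
    · have h1 := ENNReal.Tendsto.const_mul (a := ENNReal.ofReal ((k : ℝ) + 1))
        tendsto_ofReal_one_div_add_one (Or.inr ENNReal.ofReal_ne_top)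
      have h2 := ENNReal.Tendsto.const_mul (a := V ρ ^ p⁻¹) (ENNReal.Tendsto.const_mul
        (a := (V ((k : ℝ) + 1))⁻¹ ^ p⁻¹) (tendsto_of_enorm_sub_le hφ).enorm (Or.inr hVk))
        (Or.inr (hVt ρ))
      simpa only [mul_zero, zero_add] using h1.add h2
  have h0 : ∀ ρ : ℝ, eLpNorm (fn w) (ENNReal.ofReal p)
      ((volume.restrict (Ω : Set (RN N))).restrict (Metric.ball 0 ρ)) = 0 := by
    intro ρ
    have h1 : Tendsto (fun k : ℕ => V ρ ^ p⁻¹ * ((V ((k : ℝ) + 1))⁻¹ ^ p⁻¹ * ‖w‖ₑ)) atTop (𝓝 0) := by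
      have := ENNReal.Tendsto.const_mul (a := V ρ ^ p⁻¹) (ENNReal.Tendsto.mul_const (b := ‖w‖ₑ)
        (tendsto_inv_volume_ball_rpow hN hp0) (Or.inr enorm_ne_top)) (Or.inr (hVt ρ))
      simpa only [zero_mul, mul_zero] using this
    exact le_antisymm (ge_of_tendsto' h1 (key ρ)) zero_le
  have h2 : ∀ n : ℕ, ∀ᵐ x ∂(volume.restrict (Ω : Set (RN N))).restrict (Metric.ball 0 (n : ℝ)),
      fn w x = 0 := fun n =>
    (eLpNorm_eq_zero_iff ((aestronglyMeasurable_fn w).mono_measure Measure.restrict_le_self)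
      (ENNReal.ofReal_pos.2 hp0).ne').1 (h0 n)
  have h3 := (ae_restrict_iUnion_iff (fun n : ℕ => Metric.ball (0 : RN N) (n : ℝ)) _).2 h2
  rwa [Metric.iUnion_ball_nat, Measure.restrict_univ] at h3

/-- Integration against a bounded compactly supported function is weakly continuous. -/
theorem exists_continuousLinearMap_integral {g : RN N → ℝ}
    (hg : MemLp g (ENNReal.conjExponent (ENNReal.ofReal p)) (volume.restrict (Ω : Set (RN N)))) :
    ∃ l : W1p Ω p →L[ℝ] ℝ, ∀ w, l w = ∫ x in (Ω : Set (RN N)), g x * fn w x := by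
  have h1 : (1 : ℝ≥0∞) ≤ ENNReal.ofReal p := Fact.out
  have hc : ENNReal.HolderConjugate (ENNReal.ofReal p)
    (ENNReal.conjExponent (ENNReal.ofReal p)) := ENNReal.HolderConjugate.conjExponent h1
  have hc' := hc.symm
  have : Fact (1 ≤ ENNReal.conjExponent (ENNReal.ofReal p)) := ⟨hc'.one_le⟩
  refine ⟨((ContinuousLinearMap.lsmul ℝ ℝ).lpPairing (volume.restrict (Ω : Set (RN N)))
    (ENNReal.conjExponent (ENNReal.ofReal p)) (ENNReal.ofReal p) (hg.toLp g)).comp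
      ((WithLp.fstL 1 ℝ _ _).comp (W1p Ω p).subtypeL), fun w => ?_⟩
  rw [ContinuousLinearMap.comp_apply, ContinuousLinearMap.lpPairing_eq_integral]
  refine integral_congr_ae ?_
  filter_upwards [hg.coeFn_toLp] with x hx
  rw [hx]
  rfl

end W1p

/-! ### Weakly convergent sequences in `W^{1,p}_0` -/

namespace W1p

variable {Ω : Opens (RN N)} {p q : ℝ} [Fact (1 ≤ ENNReal.ofReal p)]

theorem ofTestFunction_sub (φ ψ : 𝓓(Ω, ℝ)) :
    (ofTestFunction (φ - ψ) : W1p Ω p) = ofTestFunction φ - ofTestFunction ψ := by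
  have hg : ∇ ((φ - ψ : 𝓓(Ω, ℝ)) : RN N → ℝ) = ∇ (φ : RN N → ℝ) - ∇ (ψ : RN N → ℝ) := by
    ext1 x
    rw [FunLike.coe_sub, Pi.sub_apply, gradient, fderiv_sub
      (φ.contDiff.differentiable (by simp) x) (ψ.contDiff.differentiable (by simp) x), map_sub]
    rfl
  refine Subtype.ext (congrArg (WithLp.toLp 1) (Prod.ext ?_ ?_))
  · refine Lp.ext ?_
    filter_upwards [fn_ofTestFunction (p := p) (φ - ψ), fn_ofTestFunction (p := p) φ,
      fn_ofTestFunction (p := p) ψ,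
      fn_sub (ofTestFunction φ : W1p Ω p) (ofTestFunction ψ)] with x h1 h2 h3 h4
    refine h1.trans ((?_ : _ = _).trans h4.symm)
    rw [Pi.sub_apply, h2, h3]
    rfl
  · refine Lp.ext ?_
    filter_upwards [grad_ofTestFunction (p := p) (φ - ψ), grad_ofTestFunction (p := p) φ,
      grad_ofTestFunction (p := p) ψ,
      grad_sub (ofTestFunction φ : W1p Ω p) (ofTestFunction ψ)] with x h1 h2 h3 h4
    refine h1.trans ((?_ : _ = _).trans h4.symm)
    rw [Pi.sub_apply, h2, h3, hg]
    rfl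

theorem sub_mem_W1p0 {v w : W1p Ω p} (hv : v ∈ W1p0 Ω p) (hw : w ∈ W1p0 Ω p) :
    v - w ∈ W1p0 Ω p := by
  refine map_mem_closure₂ continuous_sub hv hw ?_
  rintro _ ⟨φ, rfl⟩ _ ⟨ψ, rfl⟩
  exact ⟨φ - ψ, ofTestFunction_sub φ ψ⟩

theorem ofTestFunction_mem_W1p0 (φ : 𝓓(Ω, ℝ)) : (ofTestFunction φ : W1p Ω p) ∈ W1p0 Ω p :=
  subset_closure ⟨φ, rfl⟩

theorem normLq_fn_le_add (hq : 1 ≤ q) {C : ℝ≥0∞}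
    (hC : ∀ w ∈ W1p0 Ω p, normLq Ω q (fn w) ≤ C * ‖w‖ₑ) {v w : W1p Ω p} (hv : v ∈ W1p0 Ω p)
    (hw : w ∈ W1p0 Ω p) : normLq Ω q (fn v) ≤ normLq Ω q (fn w) + C * ‖v - w‖ₑ := by
  have h := eLpNorm_add_le (p := ENNReal.ofReal q) (aestronglyMeasurable_fn (v - w))
    (aestronglyMeasurable_fn w) (by simpa using hq)
  rw [add_comm]
  refine le_trans (le_of_eq (eLpNorm_congr_ae ?_))
    (h.trans (add_le_add (hC _ (sub_mem_W1p0 hv hw)) le_rfl))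
  filter_upwards [fn_sub v w] with x hx
  simp [hx]

/-- The average of `χ φ_n` over a ball is a continuous linear functional of `φ_n`, namely
integration against `χ` restricted to the ball and normalised. Weak convergence thus makes all local
means vanish, which is what the compactness criterion asks for. -/
theorem tendsto_eLpNorm_cutoff_zero_of_weak (hN : 2 ≤ N) (hp : 1 < p) (hpq : p ≤ q)
    (hq : IsSubcritical N p q) {φ : ℕ → 𝓓(Ω, ℝ)} {D : ℝ≥0∞} (hD : D ≠ ⊤)
    (hφD : ∀ n, ‖(ofTestFunction (φ n) : W1p Ω p)‖ₑ ≤ D)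
    (hφ : ∀ l : W1p Ω p →L[ℝ] ℝ, Tendsto (fun n => l (ofTestFunction (φ n))) atTop (𝓝 0))
    {χ : RN N → ℝ} (hχ : ContDiff ℝ ∞ χ) (hχ1 : ∀ x, |χ x| ≤ 1) {ρ ε : ℝ}
    (hρ : χ.support ⊆ Metric.ball 0 ρ) (hχε : ∀ x, ‖fderiv ℝ χ x‖ ≤ ε) :
    Tendsto (fun n => eLpNorm (fun x => χ x * φ n x) (ENNReal.ofReal q) volume) atTop (𝓝 0) := by
  have hχc : HasCompactSupport χ := HasCompactSupport.of_support_subset_isCompact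
    (isCompact_closedBall (0 : RN N) ρ) (hρ.trans Metric.ball_subset_closedBall)
  have hφ1 : ∀ n, ContDiff ℝ 1 (φ n) := fun n => (φ n).contDiff.of_le (by simp)
  have hχ' : ContDiff ℝ 1 χ := hχ.of_le (by simp)
  refine tendsto_eLpNorm_subcritical_zero_of_setAverage hN hp hpq hq (D := D + ENNReal.ofReal ε * D)
    (fun n => hχ'.mul (hφ1 n)) (fun n x hx => hρ (left_ne_zero_of_mul hx))
    (ENNReal.add_ne_top.2 ⟨hD, ENNReal.mul_ne_top ENNReal.ofReal_ne_top hD⟩) (fun n => ?_)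
    (fun n => ?_) fun x r _ => ?_
  · exact (eLpNorm_mul_le_of_abs_le_one hχ1 _).trans
      (((eLpNorm_testFunction_le_enorm (φ n)).trans (hφD n)).trans le_self_add)
  · refine (eLpNorm_fderiv_mul_le hχ' (hφ1 n) hχ1 hχε hp.le).trans ?_
    gcongr
    · exact (eLpNorm_fderiv_testFunction_le_enorm (φ n)).trans (hφD n)
    · exact (eLpNorm_testFunction_le_enorm (φ n)).trans (hφD n)
  · obtain ⟨l, hl⟩ := exists_continuousLinearMap_integral (Ω := Ω) (p := p)
      ((hχ.continuous.memLp_of_hasCompactSupport hχc).indicator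
        (measurableSet_ball (x := x) (ε := r)))
    have h1 := (hφ l).const_mul (volume.real (Metric.ball x r))⁻¹
    rw [mul_zero] at h1
    refine h1.congr fun n => ?_
    rw [setAverage_eq, smul_eq_mul, hl]
    congr 1
    calc ∫ y in (Ω : Set (RN N)), (Metric.ball x r).indicator χ y * fn (ofTestFunction (φ n)) y
        = ∫ y in (Ω : Set (RN N)), (Metric.ball x r).indicator χ y * φ n y := by
          refine integral_congr_ae ?_
          filter_upwards [fn_ofTestFunction (p := p) (φ n)] with y hy
          rw [hy]
      _ = ∫ y, (Metric.ball x r).indicator χ y * φ n y := by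
          refine setIntegral_eq_integral_of_forall_compl_eq_zero fun y hy => ?_
          rw [image_eq_zero_of_notMem_tsupport fun h => hy ((φ n).tsupport_subset h), mul_zero]
      _ = ∫ y, (Metric.ball x r).indicator (fun y => χ y * φ n y) y := by
          refine integral_congr_ae (Eventually.of_forall fun y => ?_)
          exact (Set.indicator_mul_left _ _ _).symm
      _ = ∫ y in Metric.ball x r, χ y * φ n y := integral_indicator measurableSet_ball

/-- Approximation of a weakly convergent sequence and of its limit by test functions. -/
theorem exists_testFunction_approx_of_weak {u : ℕ → W1p Ω p} {v : W1p Ω p}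
    (hu : ∀ n, u n ∈ W1p0 Ω p) (hv : v ∈ W1p0 Ω p)
    (huv : ∀ l : W1p Ω p →L[ℝ] ℝ, Tendsto (fun n => l (u n)) atTop (𝓝 (l v))) :
    ∃ (a b : ℕ → 𝓓(Ω, ℝ)) (D : ℝ≥0∞), D ≠ ⊤ ∧
      (∀ n : ℕ, ‖(ofTestFunction (a n) : W1p Ω p) - u n‖ₑ ≤ ENNReal.ofReal (1 / ((n : ℝ) + 1))) ∧
      (∀ n : ℕ, ‖(ofTestFunction (b n) : W1p Ω p) - v‖ₑ ≤ ENNReal.ofReal (1 / ((n : ℝ) + 1))) ∧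
      (∀ n, ‖(ofTestFunction (a n) : W1p Ω p)‖ₑ ≤ D) ∧
      (∀ n, ‖(ofTestFunction (a n - b n) : W1p Ω p)‖ₑ ≤ D) ∧
      ∀ l : W1p Ω p →L[ℝ] ℝ, Tendsto (fun n => l (ofTestFunction (a n - b n))) atTop (𝓝 0) := by
  obtain ⟨B, hB, huB⟩ := exists_enorm_le_of_weak huv
  have hδ1 : ∀ n : ℕ, ENNReal.ofReal (1 / ((n : ℝ) + 1)) ≤ 1 := fun n => by
    rw [ENNReal.ofReal_le_one]
    exact div_le_one_of_le₀ (by linarith [n.cast_nonneg (α := ℝ)]) (by positivity)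
  choose a ha using fun n => exists_testFunction_near (hu n) n
  choose b hb using fun n => exists_testFunction_near hv n
  have haB : ∀ n, ‖(ofTestFunction (a n) : W1p Ω p)‖ₑ ≤ 1 + B := fun n =>
    (enorm_le_enorm_sub_add _ (u n)).trans (add_le_add ((ha n).trans (hδ1 n)) (huB n))
  have hbB : ∀ n, ‖(ofTestFunction (b n) : W1p Ω p)‖ₑ ≤ 1 + ‖v‖ₑ := fun n =>
    (enorm_le_enorm_sub_add _ v).trans (add_le_add ((hb n).trans (hδ1 n)) le_rfl)
  refine ⟨a, b, (1 + B) + (1 + ‖v‖ₑ), ?_, ha, hb, fun n => (haB n).trans le_self_add,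
    fun n => ?_, fun l => ?_⟩
  · exact ENNReal.add_ne_top.2 ⟨ENNReal.add_ne_top.2 ⟨ENNReal.one_ne_top, hB⟩,
      ENNReal.add_ne_top.2 ⟨ENNReal.one_ne_top, enorm_ne_top⟩⟩
  · rw [ofTestFunction_sub]
    exact enorm_sub_le_add_of_le (haB n) (hbB n)
  · simp only [ofTestFunction_sub]
    refine tendsto_apply_sub_of_weak huv ?_ (tendsto_of_enorm_sub_le hb) l
    exact tendsto_of_enorm_sub_le fun n => (sub_zero (ofTestFunction (a n) - u n)).symm ▸ ha n

/-- No mass is lost along a weakly convergent sequence, up to the energy at infinity. -/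
theorem rpow_le_add_mul_normLq_of_weak (hN : 2 ≤ N) (hp : 1 < p) (hpq : p ≤ q)
    (hq : IsSubcritical N p q) {t m : ℝ≥0∞} (ht : t < poincareSobolevInfty Ω p q)
    {u : ℕ → W1p Ω p} {v : W1p Ω p} (hu : ∀ n, u n ∈ unitSphereLq Ω p q) (hv : v ∈ W1p0 Ω p)
    (huv : ∀ l : W1p Ω p →L[ℝ] ℝ, Tendsto (fun n => l (u n)) atTop (𝓝 (l v)))
    (hm : ∀ᶠ n in atTop, eLpNorm (grad (u n)) (ENNReal.ofReal p)
      (volume.restrict (Ω : Set (RN N))) ≤ m) :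
    t ^ p⁻¹ ≤ m + t ^ p⁻¹ * normLq Ω q (fn v) := by
  have hq1 : 1 ≤ q := by linarith
  have hE : 0 < poincareSobolevInfty Ω p q := lt_of_le_of_lt zero_le ht
  obtain ⟨C, hC, hCw⟩ := exists_sobolev_constant (Ω := Ω) hN hp hpq hq hE
  obtain ⟨a, b, D, hD, ha, hb, haD, habD, hweak⟩ :=
    exists_testFunction_approx_of_weak (fun n => (hu n).1) hv huv
  obtain ⟨R, hR⟩ := exists_lt_poincareSobolev_removeBall ht
  have hCδ := ENNReal.Tendsto.const_mul (a := C) tendsto_ofReal_one_div_add_one (Or.inr hC)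
  rw [mul_zero] at hCδ
  have hbq : ∀ n : ℕ, eLpNorm (b n) (ENNReal.ofReal q) volume ≤
      normLq Ω q (fn v) + C * ENNReal.ofReal (1 / ((n : ℝ) + 1)) := fun n => by
    rw [← eLpNorm_fn_ofTestFunction (p := p)]
    exact (normLq_fn_le_add hq1 hCw (ofTestFunction_mem_W1p0 (b n)) hv).trans
      (add_le_add le_rfl (mul_le_mul_right (hb n) _))
  have haq : ∀ n : ℕ, 1 ≤ eLpNorm (a n) (ENNReal.ofReal q) volume +
      C * ENNReal.ofReal (1 / ((n : ℝ) + 1)) := fun n => by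
    rw [← eLpNorm_fn_ofTestFunction (p := p), ← (hu n).2]
    refine (normLq_fn_le_add hq1 hCw (hu n).1 (ofTestFunction_mem_W1p0 (a n))).trans ?_
    rw [enorm_sub_rev]
    exact add_le_add le_rfl (mul_le_mul_right (ha n) _)
  -- The bound `D` does not depend on `ε`, so the cost of the cutoff disappears as `ε → 0`.
  have key : ∀ ε : ℝ, 0 < ε →
      t ^ p⁻¹ ≤ m + ENNReal.ofReal ε * D + t ^ p⁻¹ * normLq Ω q (fn v) := fun ε hε =>
    rpow_le_add_of_testFunction hε hp.le hq1 ht.ne_top hR.le tendsto_ofReal_one_div_add_one hCδ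
      haq hbq (fun n => (eLpNorm_testFunction_le_enorm (a n)).trans (haD n))
      (hm.mono fun n hn => (eLpNorm_fderiv_testFunction_le_add (a n) (u n)).trans
        (add_le_add hn (ha n)))
      fun χ hχ hχ1 hχε ⟨ρ, hρ⟩ =>
        tendsto_eLpNorm_cutoff_zero_of_weak hN hp hpq hq hD habD hweak hχ hχ1 hρ hχε
  have hlim : Tendsto (fun n : ℕ => m + ENNReal.ofReal (1 / ((n : ℝ) + 1)) * D +
      t ^ p⁻¹ * normLq Ω q (fn v)) atTop (𝓝 (m + 0 * D + t ^ p⁻¹ * normLq Ω q (fn v))) :=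
    ((ENNReal.Tendsto.mul_const tendsto_ofReal_one_div_add_one (Or.inr hD)).const_add _).add_const _
  rw [zero_mul, add_zero] at hlim
  exact ge_of_tendsto' hlim fun n => key _ (by positivity)

end W1p

/-! ### The constant -/

section Avanzo

variable {p θ : ℝ}

theorem avanzo_zero (hp : 0 < p) : avanzo p 0 = 1 := by
  have h : 1 / (2 * p) ≠ 0 := by positivity
  rw [avanzo, Real.zero_rpow h, sub_zero, mul_one]

theorem avanzo_pos (hp : 0 < p) (h0 : 0 ≤ θ) (h1 : θ < 1) : 0 < avanzo p θ :=
  mul_pos (by linarith) (sub_pos.2 (Real.rpow_lt_one h0 h1 (by positivity)))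

theorem avanzo_lt_one (h0 : 0 < θ) (h1 : θ < 1) : avanzo p θ < 1 :=
  mul_lt_one_of_nonneg_of_lt_one_left (by linarith) (by linarith)
    (by linarith [Real.rpow_nonneg h0.le (1 / (2 * p))])

/-- With `s = θ^{1/(2p)}`, the right side is `1 - s² = (1 - s)(1 + s)`, and `1 - θ ≤ 1 ≤ 1 + s`. -/
theorem avanzo_le_one_sub_rpow (hp : 0 < p) (h0 : 0 ≤ θ) (h1 : θ < 1) :
    avanzo p θ ≤ 1 - θ ^ p⁻¹ := by
  set s := θ ^ (1 / (2 * p)) with hs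
  have hs0 : 0 ≤ s := Real.rpow_nonneg h0 _
  have hs1 : s < 1 := Real.rpow_lt_one h0 h1 (by positivity)
  have hss : θ ^ p⁻¹ = s * s := by
    rw [hs, ← Real.rpow_add_of_nonneg h0 (by positivity) (by positivity)]
    congr 1
    field_simp
    norm_num
  rw [hss, avanzo]
  nlinarith [mul_nonneg (sub_nonneg.2 hs1.le) hs0, mul_nonneg (sub_nonneg.2 hs1.le) h0]

theorem tendsto_avanzo_div_top (hp : 0 < p) (M : ℝ≥0) :
    Tendsto (fun t : ℝ≥0∞ => avanzo p ((M : ℝ≥0∞) / t).toReal) (𝓝 ⊤) (𝓝 1) := by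
  have h1 : Tendsto (fun t : ℝ≥0∞ => ((M : ℝ≥0∞) / t).toReal) (𝓝 ⊤) (𝓝 0) := by
    have h2 : Tendsto (fun t : ℝ≥0∞ => (M : ℝ≥0∞) / t) (𝓝 ⊤) (𝓝 0) := by
      simpa using ENNReal.Tendsto.const_div (a := (M : ℝ≥0∞)) (tendsto_id (x := 𝓝 (⊤ : ℝ≥0∞)))
        (Or.inr ENNReal.coe_ne_top)
    exact (ENNReal.tendsto_toReal ENNReal.zero_ne_top).comp h2
  have h3 : ContinuousAt (avanzo p) 0 :=
    (continuousAt_const.sub continuousAt_id).mul (continuousAt_const.sub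
      (Real.continuousAt_rpow_const _ _ (Or.inr (by positivity))))
  have h4 := h3.tendsto.comp h1
  rwa [avanzo_zero hp] at h4

end Avanzo

/-! ### Passage to the limit in the constant and conclusion -/

/-- The limit `t → E` is taken in the product form `t (1 - U)^p ≤ M`, which makes sense for `E = ∞`
too; there `M / E = 0` and the conclusion is `U ≥ 1`. Truncated subtraction absorbs the case `U ≥
1`. -/
theorem ENNReal.one_le_add_div_rpow {p : ℝ} (hp : 0 < p) {E M U : ℝ≥0∞} (hE : E ≠ 0) (hM : M ≠ ⊤)
    (h : ∀ t < E, t ^ p⁻¹ ≤ M ^ p⁻¹ + t ^ p⁻¹ * U) : 1 ≤ U + (M / E) ^ p⁻¹ := by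
  have h1 : ∀ t < E, t * (1 - U) ^ p ≤ M := fun t ht => by
    have hτ : t ^ p⁻¹ ≠ ⊤ := ENNReal.rpow_ne_top_of_nonneg (inv_nonneg.2 hp.le) ht.ne_top
    have h2 : t ^ p⁻¹ * (1 - U) ≤ M ^ p⁻¹ := by
      rw [ENNReal.mul_sub fun _ _ => hτ, mul_one]
      exact tsub_le_iff_right.2 (h t ht)
    have h3 := ENNReal.rpow_le_rpow h2 hp.le
    rwa [ENNReal.mul_rpow_of_nonneg _ _ hp.le, ← ENNReal.rpow_mul, ← ENNReal.rpow_mul,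
      inv_mul_cancel₀ hp.ne', ENNReal.rpow_one, ENNReal.rpow_one] at h3
  have h4 : E * (1 - U) ^ p ≤ M := ENNReal.mul_le_of_forall_lt fun t ht s hs =>
    (mul_le_mul_right hs.le t).trans (h1 t ht)
  have h5 : (1 - U) ^ p ≤ M / E := by
    rw [ENNReal.le_div_iff_mul_le (Or.inl hE) (Or.inr hM), mul_comm]
    exact h4
  rw [add_comm, ← tsub_le_iff_right, ← ENNReal.rpow_le_rpow_iff hp, ← ENNReal.rpow_mul,
    inv_mul_cancel₀ hp.ne', ENNReal.rpow_one]
  exact h5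

/-- Zero energy forces the function to vanish, against its unit norm. -/
theorem energy_ne_zero_of_mem_unitSphereLq {Ω : Opens (RN N)} {p q : ℝ}
    [Fact (1 ≤ ENNReal.ofReal p)] (hN : N ≠ 0) (hp : 1 ≤ p) {u : W1p Ω p}
    (hu : u ∈ unitSphereLq Ω p q) : energy Ω p (W1p.grad u) ≠ 0 := by
  intro h
  rw [energy_eq_eLpNorm_rpow (by linarith), ENNReal.rpow_eq_zero_iff_of_pos (by linarith)] at h
  have h1 := hu.2
  rw [normLq, eLpNorm_congr_ae (W1p.fn_ae_eq_zero_of_grad hN hp hu.1 h), eLpNorm_zero] at h1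
  exact zero_ne_one h1

theorem mainTheorem8 (N : ℕ) (hN : 2 ≤ N) (p q : ℝ) [Fact (1 ≤ ENNReal.ofReal p)]
    (hp : 1 < p) (hpq : p ≤ q) (hq : IsSubcritical N p q) :
    (∀ (Ω : Opens (RN N)), ¬ Bornology.IsBounded (Ω : Set (RN N)) →
      0 < poincareSobolevInfty Ω p q →
      ∀ (M : ℝ≥0), (M : ℝ≥0∞) < poincareSobolevInfty Ω p q →
      ∀ (u : ℕ → W1p Ω p) (uInf : W1p Ω p),
        (∀ n, u n ∈ unitSphereLq Ω p q) → uInf ∈ W1p0 Ω p →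
        -- weak convergence in `W^{1,p}(Ω)`
        (∀ l : W1p Ω p →L[ℝ] ℝ, Tendsto (fun n => l (u n)) atTop (𝓝 (l uInf))) →
        (∃ n₀ : ℕ, ∀ n ≥ n₀, energy Ω p (W1p.grad (u n)) ≤ M) →
        0 < avanzo p (M / poincareSobolevInfty Ω p q).toReal ∧
        (poincareSobolevInfty Ω p q < ⊤ →
          avanzo p (M / poincareSobolevInfty Ω p q).toReal < 1) ∧
        (poincareSobolevInfty Ω p q = ⊤ →
          avanzo p (M / poincareSobolevInfty Ω p q).toReal = 1) ∧
        MemLp (W1p.fn uInf) (ENNReal.ofReal q) (volume.restrict (Ω : Set (RN N))) ∧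
        ENNReal.ofReal (avanzo p (M / poincareSobolevInfty Ω p q).toReal)
          ≤ normLq Ω q (W1p.fn uInf)) ∧
    (∀ M : ℝ≥0,
      Tendsto (fun t : ℝ≥0∞ => avanzo p ((M : ℝ≥0∞) / t).toReal) (𝓝 ⊤) (𝓝 1)) := by
  have hp0 : 0 < p := by linarith
  refine ⟨fun Ω _ hE M hM u v hu hv huv ⟨n₀, hn₀⟩ => ?_, tendsto_avanzo_div_top hp0⟩
  set E := poincareSobolevInfty Ω p q with hE_def
  -- Needed for the strict bound `avanzo p θ < 1` when `E` is finite, because `avanzo p 0 = 1`.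
  have hM0 : (M : ℝ≥0∞) ≠ 0 := fun h0 => by
    have h := hn₀ n₀ le_rfl
    rw [h0] at h
    exact energy_ne_zero_of_mem_unitSphereLq (by omega) hp.le (hu n₀) (le_antisymm h zero_le)
  have hθ1 : (M : ℝ≥0∞) / E < 1 :=
    (ENNReal.div_lt_iff (Or.inl hE.ne') (Or.inr ENNReal.coe_ne_top)).2 (by rwa [one_mul])
  set θ := ((M : ℝ≥0∞) / E).toReal with hθ
  have hθr1 : θ < 1 := by
    rw [hθ, ← ENNReal.toReal_one]
    exact (ENNReal.toReal_lt_toReal hθ1.ne_top ENNReal.one_ne_top).2 hθ1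
  have hθ0 : 0 ≤ θ := ENNReal.toReal_nonneg
  obtain ⟨C, hC, hCw⟩ := W1p.exists_sobolev_constant (Ω := Ω) hN hp hpq hq hE
  have hm : ∀ᶠ n in atTop, eLpNorm (W1p.grad (u n)) (ENNReal.ofReal p)
      (volume.restrict (Ω : Set (RN N))) ≤ (M : ℝ≥0∞) ^ p⁻¹ := by
    filter_upwards [eventually_ge_atTop n₀] with n hn
    have h := hn₀ n hn
    rw [energy_eq_eLpNorm_rpow hp0] at h
    rwa [ENNReal.le_rpow_inv_iff hp0]
  have key := ENNReal.one_le_add_div_rpow hp0 hE.ne' ENNReal.coe_ne_top fun t ht =>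
    W1p.rpow_le_add_mul_normLq_of_weak hN hp hpq hq ht hu hv huv hm
  refine ⟨avanzo_pos hp0 hθ0 hθr1, fun hEt => avanzo_lt_one ?_ hθr1, fun hEt => ?_,
    ⟨W1p.aestronglyMeasurable_fn v, lt_of_le_of_lt (hCw v hv)
      (ENNReal.mul_lt_top hC.lt_top enorm_lt_top)⟩, ?_⟩
  · exact ENNReal.toReal_pos (ENNReal.div_ne_zero.2 ⟨hM0, hEt.ne⟩) hθ1.ne_top
  · rw [hθ, hEt, ENNReal.div_top, ENNReal.toReal_zero, avanzo_zero hp0]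
  · refine (ENNReal.ofReal_le_ofReal (avanzo_le_one_sub_rpow hp0 hθ0 hθr1)).trans ?_
    rw [ENNReal.ofReal_sub _ (Real.rpow_nonneg hθ0 _), ENNReal.ofReal_one,
      ← ENNReal.ofReal_rpow_of_nonneg hθ0 (inv_nonneg.2 hp0.le), hθ,
      ENNReal.ofReal_toReal hθ1.ne_top]
    exact tsub_le_iff_right.2 key
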